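/- Let $d,n\ge 1$ be integers, $r>0$, $\beta_n\ge 0$ and $k\ge 1$ be real numbers. Let $\mathcal P_k^d(r)$ be the set of all probability distributions $P$ on $\mathbb R^d$ with $(\mathbb E_P\|X\|_2^k)^{1/k}\le r$, and let $\theta(P)=\mathbb E_P[X]$. An estimator is a measurable map $\widehat\theta:(\mathbb R^d)^n\times[0,1]\to\mathbb R^d$, $(\mathcal D_n,\xi)\mapsto\widehat\theta(\mathcal D_n;\xi)$, where $\xi\sim\mathrm{Unif}[0,1]$ is a random seed independent of the data. For $p\in[1,\infty)$ it is called $\beta_n$-$\ell_p$-stable if $$\Big\{\frac1{(n+1)^2}\sup_{\mathcal D_{n+1}\in(\mathbb R^d)^{n+1}}\ \sum_{1\le i,j\le n+1}\mathbb E_\xi\big\|\widehat\theta(\mathcal D_{n+1}^{\setminus i};\xi)-\widehat\theta(\mathcal D_{n+1}^{\setminus j};\xi)\big\|_2^p\Big\}^{1/p}\le\beta_n,$$ and $\beta_n$-$\ell_\infty$-stable if $\sup_{\mathcal D_{n+1}}\max_{i,j}\mathbb E_\xi\|\widehat\theta(\mathcal D_{n+1}^{\setminus i};\xi)-\widehat\theta(\mathcal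 D_{n+1}^{\setminus j};\xi)\|_2\le\beta_n$, where $\mathcal D_{n+1}^{\setminus i}$ is $\mathcal D_{n+1}$ with its $i$-th point deleted. Average-case stability is the case $p=1$. The estimator is called $\beta_n$-worst-case-stable if $\mathbb E_\xi\|\widehat\theta(\mathcal D_n;\xi)-\widehat\theta(\mathcal D_n';\xi)\|_2\le\beta_n$ for all data sets $\mathcal D_n,\mathcal D_n'$ that differ in at most one point. Let $$R_{n,p}(\beta_n)=\inf_{\widehat\theta\ \beta_n\text{-}\ell_p\text{-stable}}\ \sup_{P\in\mathcal P_k^d(r)}\mathbb E\|\widehat\theta(\mathcal D_n;\xi)-\theta(P)\|_2^2,$$ where $\mathcal D_n=(X_1,\dots,X_n)\sim P^{\otimes n}$. Write $a\wedge b=\min\{a,b\}$. (a) For every $k\ge1$ there are constants $0<c\le C$ depending only on $k$ such that for all $d,n,r,\beta_n$ as above $$c\Big(\tfrac{r^{2k}}{(n\beta_n)^{2(k-1)}}\wedge r^2+\tfrac{r^2}{n^{1\wedge 2(1-1/k)}}\Big)\le R_{n,\infty}(\beta_n)\le C\Big(\tfrac{r^{2k}}{(n\beta_n)^{2(k-1)}}\wedge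 r^2+\tfrac{r^2}{n^{1\wedge 2(1-1/k)}}\Big)$$ (the first quotient being $+\infty$ if $\beta_n=0$ and $k>1$, and $r^2$ if $k=1$), and the same two bounds hold for the minimax risk over $\beta_n$-worst-case-stable estimators. The upper bound is attained by the truncated mean $\bar Y=\frac1n\sum_{i=1}^nY_i$, $Y_i=X_i\mathbf 1(\|X_i\|_2\le\rho_k)$, with $\rho_k=\frac{n\beta_n}2\wedge rn^{1/k}$ if $k\in[1,2)$ and $\rho_k=\frac{n\beta_n}2$ if $k\ge2$: this estimator is $\beta_n$-$\ell_\infty$-stable and $\beta_n$-worst-case-stable, and its largest risk over $\mathcal P_k^d(r)$ is at most $C$ times the rate. (b) There are universal constants $0<c\le C$ such that for all $k,d,n,r,\beta_n$ as above $$c\,\tfrac{r^2}{n^{1\wedge 2(1-1/k)}}\le R_{n,1}(\beta_n)\le C\,\tfrac{r^2}{n^{1\wedge 2(1-1/k)}}\ \text{ if }\beta_n\ge\tfrac{24r}n,\qquad c\,r^2\le R_{n,1}(\beta_n)\le C\,r^2\ \text{ if }\beta_n\le\tfrac r{10n}.$$ Both upper bounds are attained by $\widehat\theta=\big(\frac{\beta_nn}{24r}\wedge1\big)\big(1\wedge\frac{2nr}{\sum_{i=1}^n\|Y_i\|_2}\big)\bar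 Y$ (equal to $0$ if all $Y_i=0$), where again $Y_i=X_i\mathbf 1(\|X_i\|_2\le\rho_k)$ and $\bar Y=\frac1n\sum_{i=1}^nY_i$, but now $\rho_k=rn^{1/k}$ if $k\in[1,2)$ and $\rho_k=\infty$ if $k\ge2$: this estimator is $\beta_n$-$\ell_1$-stable for every $\beta_n\ge0$, and in each of the two regimes its largest risk over $\mathcal P_k^d(r)$ is at most $C$ times the stated rate. -/

import Mathlib

open MeasureTheory
open scoped ENNReal

noncomputable section

namespace StableEstimation

section General

variable {X E : Type*} [MeasurableSpace X] [NormedAddCommGroup E] [MeasurableSpace E]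

/-- An estimator based on `n` data points in `X` and a random seed in `[0,1]`. -/
abbrev Estimator (n : ℕ) (X E : Type*) := (Fin n → X) → unitInterval → E

/-- Estimators are required to be jointly measurable in the data and the seed. -/
def IsMeasurableEstimator {n : ℕ} (est : Estimator n X E) : Prop :=
  Measurable (Function.uncurry est)

/-- Worst-case stability: replacing one data point by an arbitrary one changes the output by at
most `β`, on average over the uniform seed. -/
def IsWorstCaseStable {n : ℕ} (β : ℝ) (est : Estimator n X E) : Prop :=
  (⨆ (D : Fin n → X) (i : Fin n) (x : X),
    ∫⁻ ξ, ‖est D ξ - est (Function.update D i x) ξ‖ₑ) ≤ ENNReal.ofReal β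

/-- `ℓ_p`-stability for `1 ≤ p ≤ ∞`, through deletion of single points from data sets of size
`n + 1`. The case `p = 1` is average-case stability. -/
def IsLpStable {n : ℕ} (p : ℝ≥0∞) (β : ℝ) (est : Estimator n X E) : Prop :=
  if p = ∞ then
    (⨆ (D : Fin (n + 1) → X) (i : Fin (n + 1)) (j : Fin (n + 1)),
      ∫⁻ ξ, ‖est (i.removeNth D) ξ - est (j.removeNth D) ξ‖ₑ) ≤ ENNReal.ofReal β
  else
    ((((n : ℝ≥0∞) + 1) ^ 2)⁻¹ * ⨆ D : Fin (n + 1) → X, ∑ i : Fin (n + 1), ∑ j : Fin (n + 1),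
      ∫⁻ ξ, ‖est (i.removeNth D) ξ - est (j.removeNth D) ξ‖ₑ ^ p.toReal) ^ (1 / p.toReal)
        ≤ ENNReal.ofReal β

/-- Mean-square risk of `est` as an estimator of `t`, for `n` i.i.d. data points from `P` and an
independent uniform seed. -/
def risk {n : ℕ} (P : ProbabilityMeasure X) (t : E) (est : Estimator n X E) : ℝ≥0∞ :=
  ∫⁻ z, ‖est z.1 z.2 - t‖ₑ ^ 2
    ∂((Measure.pi fun _ : Fin n => (P : Measure X)).prod (volume : Measure unitInterval))

/-- Largest risk over the class `𝓠` for the parameter `θ`. -/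
def maxRisk {n : ℕ} (𝓠 : Set (ProbabilityMeasure X)) (θ : ProbabilityMeasure X → E)
    (est : Estimator n X E) : ℝ≥0∞ :=
  ⨆ P ∈ 𝓠, risk P (θ P) est

/-- Minimax risk over all measurable estimators that satisfy a given stability constraint. -/
def constrainedMinimaxRisk (n : ℕ) (stable : Estimator n X E → Prop)
    (𝓠 : Set (ProbabilityMeasure X)) (θ : ProbabilityMeasure X → E) : ℝ≥0∞ :=
  ⨅ (est : Estimator n X E) (_ : IsMeasurableEstimator est) (_ : stable est), maxRisk 𝓠 θ est

/-- Minimax risk over estimators satisfying worst-case stability. -/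
def worstCaseMinimaxRisk (n : ℕ) (𝓠 : Set (ProbabilityMeasure X))
    (θ : ProbabilityMeasure X → E) (β : ℝ) : ℝ≥0∞ :=
  constrainedMinimaxRisk n (IsWorstCaseStable β) 𝓠 θ

/-- Minimax risk over estimators satisfying `ℓ_p`-stability. -/
def lpMinimaxRisk (n : ℕ) (p : ℝ≥0∞) (𝓠 : Set (ProbabilityMeasure X))
    (θ : ProbabilityMeasure X → E) (β : ℝ) : ℝ≥0∞ :=
  constrainedMinimaxRisk n (IsLpStable p β) 𝓠 θ

end General

section HeavyTail

/-- Distributions on `ℝ^d` with `(E ‖X‖₂ ^ k) ^ (1 / k) ≤ r`. -/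
def momentClass (d : ℕ) (k r : ℝ) : Set (ProbabilityMeasure (EuclideanSpace ℝ (Fin d))) :=
  {P | (∫⁻ x, ‖x‖ₑ ^ k ∂(P : Measure (EuclideanSpace ℝ (Fin d)))) ^ (1 / k) ≤ ENNReal.ofReal r}

/-- The mean of a distribution on `ℝ^d`. -/
def meanOf {d : ℕ} (P : ProbabilityMeasure (EuclideanSpace ℝ (Fin d))) :
    EuclideanSpace ℝ (Fin d) :=
  ∫ x, x ∂(P : Measure (EuclideanSpace ℝ (Fin d)))

/-- The rate without stability constraint. -/
def freeRate (k r : ℝ) (n : ℕ) : ℝ≥0∞ :=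
  ENNReal.ofReal r ^ 2 / (n : ℝ≥0∞) ^ min 1 (2 * (1 - 1 / k))

/-- The rate under worst-case stability. For `β = 0` and `k > 1` the first quotient is `∞`. -/
def worstCaseRate (k r : ℝ) (n : ℕ) (β : ℝ) : ℝ≥0∞ :=
  min (ENNReal.ofReal r ^ (2 * k) / ((n : ℝ≥0∞) * ENNReal.ofReal β) ^ (2 * (k - 1)))
    (ENNReal.ofReal r ^ 2) + freeRate k r n

/-- `x` if `‖x‖₂ ≤ ρ`, and `0` otherwise. -/
def truncate {d : ℕ} (ρ : ℝ≥0∞) (x : EuclideanSpace ℝ (Fin d)) : EuclideanSpace ℝ (Fin d) :=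
  Set.indicator {y | ‖y‖ₑ ≤ ρ} id x

/-- The mean of the truncated data. -/
def truncatedMean {n d : ℕ} (ρ : ℝ≥0∞) :
    Estimator n (EuclideanSpace ℝ (Fin d)) (EuclideanSpace ℝ (Fin d)) :=
  fun D _ => (n : ℝ)⁻¹ • ∑ i, truncate ρ (D i)

/-- The self-normalized truncated mean. If the denominator vanishes, so does the truncated mean,
and the value is `0`. -/
def selfNormalizedMean {n d : ℕ} (r : ℝ) (ρ : ℝ≥0∞) :
    Estimator n (EuclideanSpace ℝ (Fin d)) (EuclideanSpace ℝ (Fin d)) :=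
  fun D ξ => min 1 (2 * n * r / ∑ i, ‖truncate ρ (D i)‖) • truncatedMean ρ D ξ

/-- Truncation level under worst-case stability. -/
def worstCaseLevel (k r : ℝ) (n : ℕ) (β : ℝ) : ℝ≥0∞ :=
  if k < 2 then min (n * ENNReal.ofReal β / 2) (ENNReal.ofReal r * (n : ℝ≥0∞) ^ (1 / k))
  else n * ENNReal.ofReal β / 2

/-- Truncation level under average-case stability; there is no truncation for `k ≥ 2`. -/
def averageCaseLevel (k r : ℝ) (n : ℕ) : ℝ≥0∞ :=
  if k < 2 then ENNReal.ofReal r * (n : ℝ≥0∞) ^ (1 / k) else ∞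

/-- The truncated mean used under worst-case stability. -/
def worstCaseEstimator (n d : ℕ) (k r β : ℝ) :
    Estimator n (EuclideanSpace ℝ (Fin d)) (EuclideanSpace ℝ (Fin d)) :=
  truncatedMean (worstCaseLevel k r n β)

/-- The shrunken self-normalized truncated mean used under average-case stability. -/
def averageCaseEstimator (n d : ℕ) (k r β : ℝ) :
    Estimator n (EuclideanSpace ℝ (Fin d)) (EuclideanSpace ℝ (Fin d)) :=
  fun D ξ => min (β * n / (24 * r)) 1 • selfNormalizedMean r (averageCaseLevel k r n) D ξ

end HeavyTail

end StableEstimation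

end

/-! All lower bounds come from laws with two atoms: a sample is then a sequence of coin flips, and
every risk is a finite sum (`risk_twoPoint`). There are three obstructions.

Without stability, Le Cam's inequality needs two laws with overlapping samples and separated means
(`freeRate_le_maxRisk`). For `k ≥ 2` these are nearly fair signs `±r`; for `k < 2` one law has an
atom of mass `1/(2n)` at distance `r * n^(1/k)`, which the sample misses with probability at least
`1/2`.

Under worst-case stability the output is Lipschitz in Hamming distance. With mass `p` at distance
`a` and the rest at `0`, a sample has `n * p` nonzero points on average, so the output moves by at
most `β * n * p` from its value on the zero sample, while the mean moves by `p * a`. Taking `a ≥ 4 *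
n * β` and the largest admissible `p = (r/a)^k` forces a risk of order `(p * a)^2`. As
`ℓ_∞`-stability implies worst-case stability, this serves both notions.

Under average-case stability, the expected output is differentiated in the bias of the coin. The
score is an average of effects of deleting a tail instead of a head (`sum_score_eq_sum_removeNth`),
which stability controls. If `β ≤ r/(10n)`, the expected output moves by at most `4r/15` between the
biases `1/4` and `3/4`, while the mean moves by `r`.

For the upper bounds, truncation at `nβ/2` makes the empirical mean stable, and bias plus variance
gives the rate. In the average case, self-normalization bounds the total effect of deletions
whatever the size of the data (`sum_norm_selfNormalized_removeNth_sub_le`), and costs no more than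
the error in estimating `E ‖Y‖ ≤ r` (`norm_selfNormalized_sub_le`). -/

noncomputable section

namespace StableEstimation

/-! ### Sequences of independent coin flips. -/

section CoinFlips

variable {n : ℕ}

/-- Probability of the outcome `b` for a coin that shows `true` with probability `q`. -/
def coinWeight (q : ℝ) (b : Bool) : ℝ := if b then q else 1 - q

/-- Probability of a sequence of independent coin flips. -/
def flipsWeight (q : ℝ) (A : Fin n → Bool) : ℝ := ∏ i, coinWeight q (A i)

lemma coinWeight_nonneg {q : ℝ} (hq : q ∈ Set.Icc (0 : ℝ) 1) (b : Bool) : 0 ≤ coinWeight q b := by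
  cases b <;> simp [coinWeight, hq.1, hq.2]

lemma flipsWeight_nonneg {q : ℝ} (hq : q ∈ Set.Icc (0 : ℝ) 1) (A : Fin n → Bool) :
    0 ≤ flipsWeight q A :=
  Finset.prod_nonneg fun _ _ => coinWeight_nonneg hq _

lemma sum_flips_prod (f : Fin n → Bool → ℝ) :
    ∑ A : Fin n → Bool, ∏ i, f i (A i) = ∏ i, ∑ b, f i b :=
  (Fintype.prod_sum f).symm

lemma sum_flipsWeight (q : ℝ) : ∑ A : Fin n → Bool, flipsWeight q A = 1 := by
  simp only [flipsWeight]
  rw [sum_flips_prod fun _ => coinWeight q]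
  simp [coinWeight]

/-- The number of heads has mean `n * q`. -/
lemma sum_flipsWeight_mul_count (q : ℝ) :
    ∑ A : Fin n → Bool, flipsWeight q A * (∑ i, if A i then (1 : ℝ) else 0) = n * q := by
  have h (i : Fin n) : ∑ A : Fin n → Bool, flipsWeight q A * (if A i then (1 : ℝ) else 0) = q := by
    have := sum_flips_prod (n := n)
      fun j b => coinWeight q b * (if j = i then (if b then (1 : ℝ) else 0) else 1)
    simp only [Finset.prod_mul_distrib] at this
    simp only [Finset.prod_ite_eq', Finset.mem_univ, if_true] at this
    refine this.trans ?_
    rw [Finset.prod_eq_single i]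
    · simp [coinWeight]
    · intro j _ hj; simp [hj, coinWeight]
    · simp
  simp_rw [Finset.mul_sum]
  rw [Finset.sum_comm, Finset.sum_congr rfl fun i _ => h i]
  simp

end CoinFlips

/-! ### Two-atom laws and Le Cam's inequality. -/

section TwoPoint

lemma enorm_sub_sq_le {E : Type*} [NormedAddCommGroup E] (x y z : E) : ‖x - y‖ₑ ^ 2 ≤ 2 * (‖z - x‖ₑ ^ 2 + ‖z - y‖ₑ ^ 2) := by
  have h : ‖x - y‖ ^ 2 ≤ 2 * (‖z - x‖ ^ 2 + ‖z - y‖ ^ 2) := by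
    have h1 : ‖x - y‖ ≤ ‖z - x‖ + ‖z - y‖ := by
      have := norm_sub_le (z - y) (z - x)
      rw [sub_sub_sub_cancel_left] at this
      linarith
    nlinarith [sq_nonneg (‖z - x‖ - ‖z - y‖), norm_nonneg (x - y)]
  have h2 := ENNReal.ofReal_le_ofReal h
  simpa [ENNReal.ofReal_mul, ENNReal.ofReal_add, ENNReal.ofReal_pow] using h2

variable {X E : Type*} [MeasurableSpace X]

/-- The law with mass `q` at `x true` and mass `1 - q` at `x false`. -/
def twoPoint (q : unitInterval) (x : Bool → X) : ProbabilityMeasure X :=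
  ⟨ENNReal.ofReal q • Measure.dirac (x true) + ENNReal.ofReal (1 - q) • Measure.dirac (x false), by
    constructor
    have h : (0 : ℝ) ≤ 1 - q := sub_nonneg.2 q.2.2
    simp [← ENNReal.ofReal_add q.2.1 h]⟩

lemma lintegral_twoPoint (q : unitInterval) (x : Bool → X) {f : X → ℝ≥0∞} (hf : Measurable f) :
    ∫⁻ y, f y ∂(twoPoint q x : Measure X)
      = ENNReal.ofReal q * f (x true) + ENNReal.ofReal (1 - q) * f (x false) := by
  simp [twoPoint, lintegral_add_measure, lintegral_smul_measure, lintegral_dirac' _ hf]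

/-- Moves the sample to `Bool`, where integrals are finite sums even if singletons of `X` are not
measurable. -/
lemma twoPoint_eq_map (q : unitInterval) (x : Bool → X) :
    (twoPoint q x : Measure X) = (twoPoint q id : Measure Bool).map x := by
  have hx : Measurable x := measurable_of_finite x
  ext s hs
  rw [Measure.map_apply hx hs]
  simp only [twoPoint, id_eq, ProbabilityMeasure.coe_mk, Measure.add_apply, Measure.smul_apply,
    Measure.dirac_apply' _ hs, Measure.dirac_apply' _ (hx hs)]
  rfl

lemma twoPoint_id_singleton (q : unitInterval) (b : Bool) :
    (twoPoint q id : Measure Bool) {b} = ENNReal.ofReal (coinWeight q b) := by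
  cases b <;> simp [twoPoint, coinWeight]

lemma lintegral_pi_twoPoint {n : ℕ} (q : unitInterval) (x : Bool → X) {f : (Fin n → X) → ℝ≥0∞}
    (hf : Measurable f) :
    ∫⁻ D, f D ∂(Measure.pi fun _ : Fin n => (twoPoint q x : Measure X))
      = ∑ A : Fin n → Bool, ENNReal.ofReal (flipsWeight q A) * f (x ∘ A) := by
  have hx : Measurable x := measurable_of_finite x
  have hmap : (Measure.pi fun _ : Fin n => (twoPoint q x : Measure X))
      = (Measure.pi fun _ : Fin n => (twoPoint q id : Measure Bool)).map fun A i => x (A i) := by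
    have (i : Fin n) : SigmaFinite ((twoPoint q id : Measure Bool).map x) := by
      rw [← twoPoint_eq_map]; infer_instance
    rw [Measure.pi_map_pi (μ := fun _ : Fin n => (twoPoint q id : Measure Bool))
      (f := fun _ => x) fun _ => hx.aemeasurable]
    simp_rw [← twoPoint_eq_map]
  rw [hmap, lintegral_map hf (measurable_of_finite _), lintegral_fintype]
  refine Finset.sum_congr rfl fun A _ => ?_
  rw [mul_comm, Measure.pi_singleton]
  simp_rw [twoPoint_id_singleton]
  rw [flipsWeight, ENNReal.ofReal_prod_of_nonneg fun i _ => coinWeight_nonneg q.2 _]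
  rfl

variable [NormedAddCommGroup E]

lemma two_mul_maxRisk_ge {n : ℕ} {𝓠 : Set (ProbabilityMeasure X)} {θ : ProbabilityMeasure X → E}
    {est : Estimator n X E} {P Q : ProbabilityMeasure X} (hP : P ∈ 𝓠) (hQ : Q ∈ 𝓠) :
    risk P (θ P) est + risk Q (θ Q) est ≤ 2 * maxRisk 𝓠 θ est := by
  rw [two_mul]
  exact add_le_add (le_iSup₂_of_le P hP le_rfl) (le_iSup₂_of_le Q hQ le_rfl)

variable [MeasurableSpace E] [OpensMeasurableSpace E]

lemma IsMeasurableEstimator.measurable_enorm_sub {n : ℕ} {est : Estimator n X E}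
    (hest : IsMeasurableEstimator est) (t : E) :
    Measurable fun z : (Fin n → X) × unitInterval => ‖est z.1 z.2 - t‖ₑ :=
  have h : Continuous fun y : E => ‖y - t‖ₑ := by fun_prop
  h.measurable.comp hest

lemma IsMeasurableEstimator.measurable_enorm_sub_seed {n : ℕ} {est : Estimator n X E}
    (hest : IsMeasurableEstimator est) (t : E) (D : Fin n → X) :
    Measurable fun ξ => ‖est D ξ - t‖ₑ :=
  (hest.measurable_enorm_sub t).comp measurable_prodMk_left

/-- Mean-square error on a fixed data set. -/
def seedRisk {n : ℕ} (est : Estimator n X E) (D : Fin n → X) (t : E) : ℝ≥0∞ :=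
  ∫⁻ ξ, ‖est D ξ - t‖ₑ ^ 2

lemma risk_twoPoint {n : ℕ} {est : Estimator n X E} (hest : IsMeasurableEstimator est)
    (q : unitInterval) (x : Bool → X) (t : E) :
    risk (twoPoint q x) t est
      = ∑ A : Fin n → Bool, ENNReal.ofReal (flipsWeight q A) * seedRisk est (x ∘ A) t := by
  have hm := (hest.measurable_enorm_sub t).pow_const 2
  rw [risk, lintegral_prod _ hm.aemeasurable]
  exact lintegral_pi_twoPoint q x hm.lintegral_prod_right'

/-- Le Cam's two-point inequality for mean-square errors. -/
lemma le_risk_add_risk {n : ℕ} {est : Estimator n X E} (hest : IsMeasurableEstimator est)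
    (p q : unitInterval) (x : Bool → X) (s t : E) :
    ENNReal.ofReal (∑ A : Fin n → Bool, min (flipsWeight p A) (flipsWeight q A)) * ‖s - t‖ₑ ^ 2
      ≤ 2 * (risk (twoPoint p x) s est + risk (twoPoint q x) t est) := by
  rw [risk_twoPoint hest, risk_twoPoint hest, ← Finset.sum_add_distrib,
    ENNReal.ofReal_sum_of_nonneg fun A _ =>
      le_min (flipsWeight_nonneg p.2 A) (flipsWeight_nonneg q.2 A),
    Finset.sum_mul, Finset.mul_sum]
  refine Finset.sum_le_sum fun A _ => ?_
  have h : ‖s - t‖ₑ ^ 2 ≤ 2 * (seedRisk est (x ∘ A) s + seedRisk est (x ∘ A) t) := by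
    have hs := (hest.measurable_enorm_sub_seed s (x ∘ A)).pow_const 2
    have ht := (hest.measurable_enorm_sub_seed t (x ∘ A)).pow_const 2
    rw [seedRisk, seedRisk, ← lintegral_add_left hs,
      ← lintegral_const_mul' _ _ ENNReal.ofNat_ne_top]
    calc ‖s - t‖ₑ ^ 2 = ∫⁻ _ : unitInterval, ‖s - t‖ₑ ^ 2 := by simp
      _ ≤ _ := lintegral_mono fun ξ => enorm_sub_sq_le _ _ _
  calc _ ≤ ENNReal.ofReal (min (flipsWeight p A) (flipsWeight q A))
        * (2 * (seedRisk est (x ∘ A) s + seedRisk est (x ∘ A) t)) := by gcongr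
    _ = 2 * (ENNReal.ofReal (min (flipsWeight p A) (flipsWeight q A)) * seedRisk est (x ∘ A) s
        + ENNReal.ofReal (min (flipsWeight p A) (flipsWeight q A)) * seedRisk est (x ∘ A) t) := by
      ring
    _ ≤ _ := by gcongr <;> simp

end TwoPoint

/-! ### Overlap of the laws of two coins. -/

section Affinity

variable {n : ℕ}

/-- The all-tails sequence suffices: its weights are `1` and `(1 - q)^n ≥ 1 - n * q = 1/2`, by
Bernoulli. -/
lemma sum_min_flipsWeight_zero_ge {q : ℝ} (hn : 1 ≤ n) (hq : q = 1 / (2 * n)) :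
    1 / 2 ≤ ∑ A : Fin n → Bool, min (flipsWeight 0 A) (flipsWeight q A) := by
  have hn' : (1 : ℝ) ≤ n := by exact_mod_cast hn
  have hq0 : 0 ≤ q := by rw [hq]; positivity
  have hq1 : q ≤ 1 := by
    rw [hq, div_le_one (by positivity)]; linarith
  have h := Finset.single_le_sum (f := fun A : Fin n → Bool => min (flipsWeight 0 A)
    (flipsWeight q A)) (fun A _ => le_min (flipsWeight_nonneg (by simp) A)
      (flipsWeight_nonneg ⟨hq0, hq1⟩ A)) (Finset.mem_univ fun _ => false)
  refine le_trans ?_ h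
  have hb := one_add_mul_le_pow (a := -q) (by linarith) n
  have : (n : ℝ) * q = 1 / 2 := by rw [hq]; field_simp
  simp only [flipsWeight, coinWeight, Bool.false_eq_true, if_false, sub_zero, Finset.prod_const_one,
    Finset.prod_const, Finset.card_univ, Fintype.card_fin, le_min_iff]
  constructor
  · norm_num
  · rw [sub_eq_add_neg]; linarith

/-- A chi-square argument: with `W = 2^(-n)` and `w` the biased weight, `min W w ≥ w - w^2 / (4W)`.
The sum of `w^2 / W` factorizes to `(1 + 1/n)^n ≤ e`, and `1 - e/4 ≥ 1/4`. -/
lemma sum_min_flipsWeight_half_ge {q : ℝ} (hn : 1 ≤ n)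
    (hq : q = 1 / 2 + 1 / (2 * Real.sqrt n)) :
    1 / 4 ≤ ∑ A : Fin n → Bool, min (flipsWeight (1 / 2) A) (flipsWeight q A) := by
  have hn' : (1 : ℝ) ≤ n := by exact_mod_cast hn
  have hW (A : Fin n → Bool) : flipsWeight (1 / 2) A = (1 / 2) ^ n := by
    have (b : Bool) : coinWeight (1 / 2) b = 1 / 2 := by cases b <;> norm_num [coinWeight]
    simp only [flipsWeight, this, Finset.prod_const, Finset.card_univ, Fintype.card_fin]
  have h1 (A : Fin n → Bool) : flipsWeight q A - 1 / 4 * (2 ^ n * flipsWeight q A ^ 2)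
      ≤ min (flipsWeight (1 / 2) A) (flipsWeight q A) := by
    rw [hW, le_min_iff]
    have h2 : ((1 / 2 : ℝ)) ^ n * 2 ^ n = 1 := by rw [← mul_pow]; norm_num
    have h3 : (0 : ℝ) < 2 ^ n := by positivity
    constructor
    · refine le_of_mul_le_mul_right ?_ h3
      rw [h2]
      nlinarith [sq_nonneg (2 ^ n * flipsWeight q A / 2 - 1)]
    · have : 0 ≤ 2 ^ n * flipsWeight q A ^ 2 := by positivity
      linarith
  refine le_trans ?_ (Finset.sum_le_sum fun A _ => h1 A)
  rw [Finset.sum_sub_distrib, sum_flipsWeight, ← Finset.mul_sum, ← Finset.mul_sum]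
  simp only [flipsWeight, ← Finset.prod_pow]
  rw [sum_flips_prod fun _ b => coinWeight q b ^ 2]
  simp only [Fintype.sum_bool, coinWeight, if_true, Bool.false_eq_true, if_false, Finset.prod_const,
    Finset.card_univ, Fintype.card_fin]
  rw [← mul_pow]
  have hs : Real.sqrt n ^ 2 = n := Real.sq_sqrt (by positivity)
  have hs0 : 0 < Real.sqrt n := Real.sqrt_pos.2 (by linarith)
  have h4 : 2 * (q ^ 2 + (1 - q) ^ 2) = 1 / n + 1 := by
    rw [hq, show 1 / (n : ℝ) = 1 / Real.sqrt n ^ 2 by rw [hs]]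
    field_simp
    ring
  rw [h4]
  have h5 : (1 / (n : ℝ) + 1) ^ n ≤ Real.exp 1 := by
    calc (1 / (n : ℝ) + 1) ^ n ≤ Real.exp (1 / n) ^ n := by
          gcongr; exact Real.add_one_le_exp _
      _ = Real.exp 1 := by
          rw [← Real.exp_nat_mul]; congr 1; field_simp
  have h6 := Real.exp_one_lt_d9
  linarith

end Affinity

/-! ### Two-atom laws in the moment class; the unconstrained lower bound. -/

section MomentClass

variable {d n : ℕ} {k r : ℝ}

lemma mem_momentClass_iff (hk : 1 ≤ k) {P : ProbabilityMeasure (EuclideanSpace ℝ (Fin d))} :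
    P ∈ momentClass d k r ↔
      ∫⁻ x, ‖x‖ₑ ^ k ∂(P : Measure (EuclideanSpace ℝ (Fin d))) ≤ ENNReal.ofReal r ^ k := by
  rw [momentClass, Set.mem_ofPred_eq, one_div, ENNReal.rpow_inv_le_iff (by linarith)]

lemma twoPoint_mem_momentClass (hk : 1 ≤ k) (hr : 0 ≤ r) (q : unitInterval)
    {x : Bool → EuclideanSpace ℝ (Fin d)}
    (h : q * ‖x true‖ ^ k + (1 - q) * ‖x false‖ ^ k ≤ r ^ k) :
    twoPoint q x ∈ momentClass d k r := by
  have hk0 : 0 ≤ k := by linarith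
  have hq : (0 : ℝ) ≤ 1 - q := sub_nonneg.2 q.2.2
  rw [mem_momentClass_iff hk, lintegral_twoPoint _ _ (by fun_prop),
    ENNReal.ofReal_rpow_of_nonneg hr hk0]
  simp_rw [← ofReal_norm]
  rw [ENNReal.ofReal_rpow_of_nonneg (norm_nonneg _) hk0,
    ENNReal.ofReal_rpow_of_nonneg (norm_nonneg _) hk0, ← ENNReal.ofReal_mul q.2.1,
    ← ENNReal.ofReal_mul hq, ← ENNReal.ofReal_add]
  · exact ENNReal.ofReal_le_ofReal h
  · exact mul_nonneg q.2.1 (by positivity)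
  · exact mul_nonneg hq (by positivity)

lemma meanOf_twoPoint (q : unitInterval) (x : Bool → EuclideanSpace ℝ (Fin d)) :
    meanOf (twoPoint q x) = (q : ℝ) • x true + (1 - q : ℝ) • x false := by
  have hq : (0 : ℝ) ≤ 1 - q := sub_nonneg.2 q.2.2
  have hi (y : EuclideanSpace ℝ (Fin d)) (c : ℝ) :
      Integrable (fun z : EuclideanSpace ℝ (Fin d) => z)
        (ENNReal.ofReal c • Measure.dirac y) :=
    (integrable_dirac (by simp)).smul_measure ENNReal.ofReal_ne_top
  simp only [meanOf, twoPoint, ProbabilityMeasure.coe_mk]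
  rw [integral_add_measure (hi _ _) (hi _ _), integral_smul_measure, integral_smul_measure,
    integral_dirac, integral_dirac, ENNReal.toReal_ofReal q.2.1, ENNReal.toReal_ofReal hq]

/-- A unit vector of `ℝ^d`. -/
lemma exists_norm_eq_one (hd : 1 ≤ d) : ∃ e : EuclideanSpace ℝ (Fin d), ‖e‖ = 1 :=
  ⟨EuclideanSpace.single ⟨0, hd⟩ 1, by simp⟩

lemma ofReal_le_of_mul_le_mul {c u : ℝ} {M : ℝ≥0∞} (hc : 0 < c)
    (h : ENNReal.ofReal (c * u) ≤ ENNReal.ofReal c * M) : ENNReal.ofReal u ≤ M := by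
  rw [ENNReal.ofReal_mul hc.le] at h
  exact (ENNReal.mul_le_mul_iff_right (by simpa using hc) ENNReal.ofReal_ne_top).1 h

lemma freeRate_eq_ofReal (hn : 1 ≤ n) (hr : 0 ≤ r) :
    freeRate k r n = ENNReal.ofReal (r ^ 2 / (n : ℝ) ^ min 1 (2 * (1 - 1 / k))) := by
  have hn' : (0 : ℝ) < n := by exact_mod_cast hn
  rw [freeRate, ENNReal.ofReal_div_of_pos (by positivity), ENNReal.ofReal_pow hr,
    ← ENNReal.ofReal_rpow_of_pos hn', ENNReal.ofReal_natCast]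

/-- No estimator has a maximal risk below a fixed multiple of the unconstrained rate. -/
theorem freeRate_le_maxRisk (hd : 1 ≤ d) (hn : 1 ≤ n) (hk : 1 ≤ k) (hr : 0 < r)
    {est : Estimator n (EuclideanSpace ℝ (Fin d)) (EuclideanSpace ℝ (Fin d))}
    (hest : IsMeasurableEstimator est) :
    ENNReal.ofReal (1 / 32) * freeRate k r n ≤ maxRisk (momentClass d k r) meanOf est := by
  have hk0 : 0 < k := by linarith
  have hn' : (1 : ℝ) ≤ n := by exact_mod_cast hn
  obtain ⟨e, he⟩ := exists_norm_eq_one hd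
  -- It is enough to exhibit two laws with overlapping samples and well separated means.
  have key (p q : unitInterval) (x : Bool → EuclideanSpace ℝ (Fin d)) (a t : ℝ)
      (hp : twoPoint p x ∈ momentClass d k r) (hq : twoPoint q x ∈ momentClass d k r) (ha : 0 ≤ a)
      (haff : a ≤ ∑ A : Fin n → Bool, min (flipsWeight p A) (flipsWeight q A))
      (hsep : ‖meanOf (twoPoint p x) - meanOf (twoPoint q x)‖ ^ 2 = t)
      (hat : r ^ 2 / (n : ℝ) ^ min 1 (2 * (1 - 1 / k)) ≤ 8 * (a * t)) :
      ENNReal.ofReal (1 / 32) * freeRate k r n ≤ maxRisk (momentClass d k r) meanOf est := by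
    rw [freeRate_eq_ofReal hn hr.le, ← ENNReal.ofReal_mul (by norm_num)]
    -- The `4` is Le Cam's factor `2` times the `2` from bounding a sum of two risks by the maximal
    -- one; with the `8` in `hat` it makes up `1/32`.
    refine ofReal_le_of_mul_le_mul (c := 4) (by norm_num) ?_
    calc ENNReal.ofReal (4 * (1 / 32 * (r ^ 2 / (n : ℝ) ^ min 1 (2 * (1 - 1 / k)))))
        ≤ ENNReal.ofReal (a * t) := ENNReal.ofReal_le_ofReal (by linarith)
      _ ≤ ENNReal.ofReal (∑ A : Fin n → Bool, min (flipsWeight p A) (flipsWeight q A))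
          * ‖meanOf (twoPoint p x) - meanOf (twoPoint q x)‖ₑ ^ 2 := by
          rw [← hsep, ENNReal.ofReal_mul ha, ENNReal.ofReal_pow (norm_nonneg _),
            ofReal_norm]
          gcongr
      _ ≤ 2 * (risk (twoPoint p x) (meanOf (twoPoint p x)) est
          + risk (twoPoint q x) (meanOf (twoPoint q x)) est) := le_risk_add_risk hest p q x _ _
      _ ≤ 2 * (2 * maxRisk (momentClass d k r) meanOf est) := by
          gcongr; exact two_mul_maxRisk_ge hp hq
      _ = ENNReal.ofReal 4 * maxRisk (momentClass d k r) meanOf est := by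
          rw [← mul_assoc]; norm_num
  rcases le_or_gt 2 k with hk2 | hk2
  · have hmin : min 1 (2 * (1 - 1 / k)) = 1 := by
      rw [min_eq_left]
      have : 1 / k ≤ 1 / 2 := one_div_le_one_div_of_le (by norm_num) hk2
      linarith
    have hs1 : 1 ≤ Real.sqrt n := Real.one_le_sqrt.2 hn'
    have hs : Real.sqrt n ^ 2 = n := Real.sq_sqrt (by positivity)
    have hs2 : 1 / (2 * Real.sqrt n) ≤ 1 / 2 := one_div_le_one_div_of_le (by norm_num) (by linarith)
    have hs3 : 0 ≤ 1 / (2 * Real.sqrt n) := by positivity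
    let p : unitInterval := ⟨1 / 2, by norm_num, by norm_num⟩
    -- A bias of order `1/√n` is the largest that `n` flips cannot detect reliably. Both atoms have
    -- norm `r`, so every bias is admissible.
    let q : unitInterval := ⟨1 / 2 + 1 / (2 * Real.sqrt n), by linarith, by linarith⟩
    let x : Bool → EuclideanSpace ℝ (Fin d) := fun b => if b then r • e else -(r • e)
    have hx (b : Bool) : ‖x b‖ = r := by
      cases b <;> simp [x, norm_smul, he, abs_of_pos hr]
    have hmem (s : unitInterval) : twoPoint s x ∈ momentClass d k r :=
      twoPoint_mem_momentClass hk hr.le s (by rw [hx, hx]; linarith)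
    refine key p q x (1 / 4) (r ^ 2 / n) (hmem _) (hmem _) (by norm_num)
      (sum_min_flipsWeight_half_ge hn rfl) ?_ ?_
    · rw [meanOf_twoPoint, meanOf_twoPoint]
      have : (p : ℝ) • x true + (1 - p : ℝ) • x false - ((q : ℝ) • x true + (1 - q : ℝ) • x false)
          = -(r / Real.sqrt n) • e := by
        simp only [p, q, x, if_true, Bool.false_eq_true, if_false]
        module
      rw [this, norm_smul, he, mul_one, norm_neg, Real.norm_eq_abs, sq_abs, div_pow, hs]
    · rw [hmin, Real.rpow_one]
      have : 0 ≤ r ^ 2 / n := by positivity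
      linarith
  · have hmin : min 1 (2 * (1 - 1 / k)) = 2 * (1 - 1 / k) := by
      rw [min_eq_right]
      have : 1 / 2 ≤ 1 / k := one_div_le_one_div_of_le (by linarith) hk2.le
      linarith
    let p : unitInterval := 0
    have hq1 : 1 / (2 * (n : ℝ)) ≤ 1 := by
      rw [div_le_one (by positivity)]; linarith
    let q : unitInterval := ⟨1 / (2 * n), by positivity, hq1⟩
    -- The farthest atom that may carry mass `1/n`, since `a^k = r^k * n`.
    set a : ℝ := r * (n : ℝ) ^ (1 / k) with ha
    have ha0 : 0 ≤ a := by positivity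
    let x : Bool → EuclideanSpace ℝ (Fin d) := fun b => if b then a • e else 0
    have hak : a ^ k = r ^ k * n := by
      rw [ha, Real.mul_rpow hr.le (by positivity), ← Real.rpow_mul (by positivity),
        one_div_mul_cancel hk0.ne', Real.rpow_one]
    have hmem (s : unitInterval) (h : (s : ℝ) * n ≤ 1) : twoPoint s x ∈ momentClass d k r := by
      refine twoPoint_mem_momentClass hk hr.le s ?_
      simp only [x, if_true, Bool.false_eq_true, if_false, norm_smul, he, mul_one, norm_zero,
        Real.norm_of_nonneg ha0, Real.zero_rpow hk0.ne', mul_zero, add_zero, hak]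
      have : 0 < r ^ k := by positivity
      nlinarith
    refine key p q x (1 / 2) ((1 / (2 * n) * a) ^ 2) (hmem _ ?_) (hmem _ ?_) (by norm_num)
      (sum_min_flipsWeight_zero_ge hn rfl) ?_ ?_
    · simp [p]
    · simp only [q]; field_simp; norm_num
    · rw [meanOf_twoPoint, meanOf_twoPoint]
      have : (p : ℝ) • x true + (1 - p : ℝ) • x false - ((q : ℝ) • x true + (1 - q : ℝ) • x false)
          = -(1 / (2 * n) * a) • e := by
        simp only [p, q, x, if_true, Bool.false_eq_true, if_false, Set.Icc.coe_zero]
        module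
      rw [this, norm_smul, he, mul_one, norm_neg, Real.norm_eq_abs, sq_abs]
    · rw [hmin, show 2 * (1 - 1 / k) = 2 - 2 * (1 / k) by ring, Real.rpow_sub (by positivity),
        mul_comm 2 (1 / k), Real.rpow_mul (by positivity), Real.rpow_two, Real.rpow_two, ha]
      refine le_of_eq ?_
      field_simp
      norm_num

end MomentClass

/-! ### Deletion versus replacement, and Hamming-Lipschitz outputs. -/

section WorstCase

variable {X E : Type*} [NormedAddCommGroup E] {n : ℕ}

/-- Inserting `x` at position `i` pushes `D i` to position `i + 1`; deleting it there leaves `x` in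
its place, whereas deleting `x` restores `D`. -/
lemma removeNth_succ_insertNth_castSucc (D : Fin n → X) (i : Fin n) (x : X) :
    i.succ.removeNth (i.castSucc.insertNth x D : Fin (n + 1) → X) = Function.update D i x := by
  ext j
  rw [Fin.removeNth]
  rcases eq_or_ne j i with rfl | hj
  · rw [Fin.succAbove_succ_self, Fin.insertNth_apply_same, Function.update_self]
  · have : i.succ.succAbove j = i.castSucc.succAbove j := by
      rcases lt_or_gt_of_ne hj with h | h
      · rw [Fin.succAbove_of_castSucc_lt _ _ (Fin.castSucc_lt_castSucc_iff.2 h),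
          Fin.succAbove_of_castSucc_lt _ _ (Fin.castSucc_lt_succ_iff.2 h.le)]
      · rw [Fin.succAbove_of_lt_succ _ _ (Fin.succ_lt_succ_iff.2 h),
          Fin.succAbove_of_lt_succ _ _ (Fin.castSucc_lt_succ_iff.2 h.le)]
    rw [this, Fin.insertNth_apply_succAbove, Function.update_of_ne hj]

/-- Deleting either of two neighbouring points amounts to replacing one point, so worst-case
stability is implied by `ℓ_∞`-stability. -/
lemma IsLpStable.isWorstCaseStable {β : ℝ} {est : Estimator n X E} (h : IsLpStable ∞ β est) :
    IsWorstCaseStable β est := by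
  rw [IsLpStable, if_pos rfl] at h
  refine iSup_le fun D => iSup_le fun i => iSup_le fun x => le_trans ?_ h
  refine le_iSup_of_le (i.castSucc.insertNth x D) <| le_iSup_of_le i.castSucc <|
    le_iSup_of_le i.succ ?_
  rw [removeNth_succ_insertNth_castSucc, Fin.removeNth_insertNth]

lemma IsMeasurableEstimator.measurable_seed {X E : Type*} [MeasurableSpace X] [MeasurableSpace E]
    {est : Estimator n X E}
    (hest : IsMeasurableEstimator est) (D : Fin n → X) : Measurable (est D) :=
  hest.comp measurable_prodMk_left

variable [MeasurableSpace X] [MeasurableSpace E] [BorelSpace E] [SecondCountableTopology E]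

/-- Under worst-case stability, the output is Lipschitz for the Hamming distance. -/
lemma IsWorstCaseStable.lintegral_piecewise_le {β : ℝ} {est : Estimator n X E}
    (hest : IsMeasurableEstimator est) (h : IsWorstCaseStable β est) (D D' : Fin n → X)
    (S : Finset (Fin n)) :
    ∫⁻ ξ, ‖est D ξ - est (S.piecewise D' D) ξ‖ₑ ≤ S.card * ENNReal.ofReal β := by
  induction S using Finset.induction_on with
  | empty => simp
  | insert i S hi ih =>
    rw [Finset.piecewise_insert, Finset.card_insert_of_notMem hi]
    set D₁ := S.piecewise D' D
    have h1 : ∫⁻ ξ, ‖est D₁ ξ - est (Function.update D₁ i (D' i)) ξ‖ₑ ≤ ENNReal.ofReal β :=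
      le_trans (le_iSup_of_le D₁ <| le_iSup_of_le i <| le_iSup (fun y => ∫⁻ ξ,
        ‖est D₁ ξ - est (Function.update D₁ i y) ξ‖ₑ) (D' i)) h
    calc ∫⁻ ξ, ‖est D ξ - est (Function.update D₁ i (D' i)) ξ‖ₑ
        ≤ ∫⁻ ξ, (‖est D ξ - est D₁ ξ‖ₑ + ‖est D₁ ξ - est (Function.update D₁ i (D' i)) ξ‖ₑ) := by
          refine lintegral_mono fun ξ => ?_
          rw [← sub_add_sub_cancel (est D ξ) (est D₁ ξ)]
          exact enorm_add_le _ _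
      _ = (∫⁻ ξ, ‖est D ξ - est D₁ ξ‖ₑ)
          + ∫⁻ ξ, ‖est D₁ ξ - est (Function.update D₁ i (D' i)) ξ‖ₑ :=
          lintegral_add_left ((hest.measurable_seed D).sub (hest.measurable_seed D₁)).enorm _
      _ ≤ S.card * ENNReal.ofReal β + ENNReal.ofReal β := add_le_add ih h1
      _ = _ := by push_cast; ring

end WorstCase

/-! ### Comparing a sparse sample with the zero sample. -/

section Transport

variable {X E : Type*} [NormedAddCommGroup E] {n : ℕ}

/-- The triangle inequality through `u` and `w`, multiplied by `‖v‖`; each of the two error terms is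
split by AM-GM at a cost of `‖v‖^2 / 8`. The term in `w - u` stays linear because stability controls
a first moment only. -/
lemma enorm_sq_le_of_transport (u w v : E) :
    ENNReal.ofReal (3 / 4 * ‖v‖ ^ 2)
      ≤ ENNReal.ofReal ‖v‖ * ‖w - u‖ₑ + (2 * ‖u - 0‖ₑ ^ 2 + 2 * ‖w - v‖ₑ ^ 2) := by
  have h : 3 / 4 * ‖v‖ ^ 2 ≤ ‖v‖ * ‖w - u‖ + (2 * ‖u - 0‖ ^ 2 + 2 * ‖w - v‖ ^ 2) := by
    have h1 : ‖v‖ ≤ ‖w - u‖ + ‖u‖ + ‖w - v‖ := by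
      calc ‖v‖ = ‖(w - u) + u - (w - v)‖ := by congr 1; abel
        _ ≤ _ := (norm_sub_le _ _).trans (add_le_add_left (norm_add_le _ _) _)
    rw [sub_zero]
    nlinarith [mul_le_mul_of_nonneg_left h1 (norm_nonneg v), sq_nonneg (‖v‖ / 4 - ‖u‖),
      sq_nonneg (‖v‖ / 4 - ‖w - v‖)]
  have h2 := ENNReal.ofReal_le_ofReal h
  rw [ENNReal.ofReal_add (by positivity) (by positivity), ENNReal.ofReal_mul (norm_nonneg _),
    ENNReal.ofReal_add (by positivity) (by positivity), ENNReal.ofReal_mul zero_le_two,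
    ENNReal.ofReal_mul zero_le_two, ENNReal.ofReal_pow (norm_nonneg _),
    ENNReal.ofReal_pow (norm_nonneg _)] at h2
  simpa using h2

variable [MeasurableSpace X] [MeasurableSpace E] [BorelSpace E] [SecondCountableTopology E]

/-- If an estimator hardly moves when a few zeros are replaced by `true`, it cannot estimate the
mean well both under the law of all zeros and under a law with rare `true`s. -/
lemma IsWorstCaseStable.le_risk_add_risk {β : ℝ} (hβ : 0 ≤ β) {est : Estimator n X E}
    (hest : IsMeasurableEstimator est) (h : IsWorstCaseStable β est) (p : unitInterval)
    (x : Bool → X) (v : E) (hp : β * (n * p) ≤ ‖v‖ / 4) :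
    ENNReal.ofReal (‖v‖ ^ 2 / 2)
      ≤ 2 * (risk (twoPoint 0 x) 0 est + risk (twoPoint p x) v est) := by
  set D₀ : Fin n → X := x ∘ fun _ => false with hD₀
  set W : (Fin n → Bool) → ℝ≥0∞ := fun A => ENNReal.ofReal (flipsWeight p A)
  have hW : ∑ A, W A = 1 := by
    rw [← ENNReal.ofReal_sum_of_nonneg fun A _ => flipsWeight_nonneg p.2 A, sum_flipsWeight,
      ENNReal.ofReal_one]
  have hmove (A : Fin n → Bool) : ∫⁻ ξ, ‖est (x ∘ A) ξ - est D₀ ξ‖ₑ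
      ≤ ENNReal.ofReal (β * ∑ i, if A i then (1 : ℝ) else 0) := by
    have h1 := h.lintegral_piecewise_le hest (x ∘ A) D₀ (Finset.univ.filter fun i => A i = true)
    have h2 : (Finset.univ.filter fun i => A i = true).piecewise D₀ (x ∘ A) = D₀ := by
      ext i
      by_cases hi : A i = true
      · simp [Finset.piecewise, hi]
      · simp [Finset.piecewise, hD₀, hi]
    rw [h2] at h1
    refine h1.trans_eq ?_
    rw [ENNReal.ofReal_mul hβ, mul_comm]
    congr 1
    rw [Finset.sum_boole, ENNReal.ofReal_natCast]
  have hA (A : Fin n → Bool) : ENNReal.ofReal (3 / 4 * ‖v‖ ^ 2)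
      ≤ ENNReal.ofReal ‖v‖ * ENNReal.ofReal (β * ∑ i, if A i then (1 : ℝ) else 0)
        + (2 * seedRisk est D₀ 0 + 2 * seedRisk est (x ∘ A) v) := by
    refine le_trans ?_ (add_le_add_left (mul_le_mul_right (hmove A) _) _)
    have m1 : Measurable fun ξ => ‖est (x ∘ A) ξ - est D₀ ξ‖ₑ :=
      ((hest.measurable_seed _).sub (hest.measurable_seed D₀)).enorm
    have m2 := (hest.measurable_enorm_sub_seed 0 D₀).pow_const 2
    have m3 := (hest.measurable_enorm_sub_seed v (x ∘ A)).pow_const 2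
    rw [seedRisk, seedRisk, ← lintegral_const_mul _ m1, ← lintegral_const_mul _ m2,
      ← lintegral_const_mul _ m3, ← lintegral_add_left (m2.const_mul 2),
      ← lintegral_add_left (m1.const_mul _)]
    calc ENNReal.ofReal (3 / 4 * ‖v‖ ^ 2)
        = ∫⁻ _ : unitInterval, ENNReal.ofReal (3 / 4 * ‖v‖ ^ 2) := by simp
      _ ≤ _ := lintegral_mono fun ξ => enorm_sq_le_of_transport _ _ _
  -- The Hamming distance to `D₀` is at most the number of heads, whose mean is `n * p`.
  have hcount : ∑ A, W A * ENNReal.ofReal (β * ∑ i, if A i then (1 : ℝ) else 0)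
      ≤ ENNReal.ofReal (‖v‖ / 4) := by
    have hnn (A : Fin n → Bool) : 0 ≤ β * ∑ i, if A i then (1 : ℝ) else 0 :=
      mul_nonneg hβ (Finset.sum_nonneg fun i _ => by split_ifs <;> norm_num)
    have hW0 (A : Fin n → Bool) := flipsWeight_nonneg p.2 A
    simp_rw [W, ← ENNReal.ofReal_mul (hW0 _)]
    rw [← ENNReal.ofReal_sum_of_nonneg fun A _ => mul_nonneg (hW0 A) (hnn A)]
    refine ENNReal.ofReal_le_ofReal (le_trans (le_of_eq ?_) hp)
    rw [← sum_flipsWeight_mul_count, Finset.mul_sum]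
    exact Finset.sum_congr rfl fun A _ => by ring
  -- A coin of bias `0` produces the sample `D₀` with certainty.
  have h0 : seedRisk est D₀ 0 ≤ risk (twoPoint 0 x) 0 est := by
    rw [risk_twoPoint hest]
    refine le_trans ?_ (Finset.single_le_sum (fun _ _ => zero_le) (Finset.mem_univ fun _ => false))
    simp [flipsWeight, coinWeight, hD₀]
  have hsum : ENNReal.ofReal (3 / 4 * ‖v‖ ^ 2) ≤ ENNReal.ofReal (‖v‖ ^ 2 / 4)
      + 2 * (risk (twoPoint 0 x) 0 est + risk (twoPoint p x) v est) := by
    calc ENNReal.ofReal (3 / 4 * ‖v‖ ^ 2)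
        = ∑ A, W A * ENNReal.ofReal (3 / 4 * ‖v‖ ^ 2) := by rw [← Finset.sum_mul, hW, one_mul]
      _ ≤ ∑ A, W A * (ENNReal.ofReal ‖v‖
            * ENNReal.ofReal (β * ∑ i, if A i then (1 : ℝ) else 0)
            + (2 * seedRisk est D₀ 0 + 2 * seedRisk est (x ∘ A) v)) :=
          Finset.sum_le_sum fun A _ => mul_le_mul_right (hA A) _
      _ = ENNReal.ofReal ‖v‖
            * (∑ A, W A * ENNReal.ofReal (β * ∑ i, if A i then (1 : ℝ) else 0))
          + ((∑ A, W A) * (2 * seedRisk est D₀ 0)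
            + 2 * ∑ A, W A * seedRisk est (x ∘ A) v) := by
          simp only [mul_add, Finset.sum_add_distrib, Finset.mul_sum, Finset.sum_mul]
          congr 1
          · exact Finset.sum_congr rfl fun A _ => by ring
          · congr 1
            exact Finset.sum_congr rfl fun A _ => by ring
      _ ≤ ENNReal.ofReal ‖v‖ * ENNReal.ofReal (‖v‖ / 4)
          + (2 * risk (twoPoint 0 x) 0 est + 2 * risk (twoPoint p x) v est) := by
          rw [hW, one_mul, risk_twoPoint hest p]
          gcongr
      _ = _ := by
          rw [← ENNReal.ofReal_mul (norm_nonneg _), mul_add]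
          congr 2
          ring
  rw [show 3 / 4 * ‖v‖ ^ 2 = ‖v‖ ^ 2 / 4 + ‖v‖ ^ 2 / 2 by ring,
    ENNReal.ofReal_add (by positivity) (by positivity)] at hsum
  exact (ENNReal.add_le_add_iff_left ENNReal.ofReal_ne_top).1 hsum

end Transport

/-! ### Lower bound under worst-case stability. -/

section WorstCaseLowerBound

variable {d n : ℕ} {k r β : ℝ}

/-- The price of worst-case stability. -/
theorem IsWorstCaseStable.le_maxRisk (hd : 1 ≤ d) (hk : 1 ≤ k) (hr : 0 < r) (hβ : 0 ≤ β)
    {est : Estimator n (EuclideanSpace ℝ (Fin d)) (EuclideanSpace ℝ (Fin d))}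
    (hest : IsMeasurableEstimator est) (h : IsWorstCaseStable β est) :
    ENNReal.ofReal (1 / 8 * (1 / 4) ^ (2 * (k - 1))) *
        min (ENNReal.ofReal r ^ (2 * k) / ((n : ℝ≥0∞) * ENNReal.ofReal β) ^ (2 * (k - 1)))
          (ENNReal.ofReal r ^ 2)
      ≤ maxRisk (momentClass d k r) meanOf est := by
  have hk0 : 0 < k := by linarith
  obtain ⟨e, he⟩ := exists_norm_eq_one hd
  -- `a ≥ r` keeps `p = (r/a)^k` below `1`; `a ≥ 4 * n * β` makes the expected movement `β * n * p`
  -- at most a quarter of the shift `p * a` of the mean.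
  set a : ℝ := max r (4 * (n * β)) with ha
  have har : r ≤ a := le_max_left _ _
  have ha0 : 0 < a := hr.trans_le har
  have hp1 : (r / a) ^ k ≤ 1 :=
    Real.rpow_le_one (by positivity) ((div_le_one ha0).2 har) hk0.le
  let p : unitInterval := ⟨(r / a) ^ k, by positivity, hp1⟩
  let x : Bool → EuclideanSpace ℝ (Fin d) := fun b => if b then a • e else 0
  have hpa : (p : ℝ) * a ^ k = r ^ k := by
    rw [show (p : ℝ) = (r / a) ^ k from rfl, ← Real.mul_rpow (by positivity) ha0.le,
      div_mul_cancel₀ _ ha0.ne']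
  have hmem (s : unitInterval) (hs : s ≤ p) : twoPoint s x ∈ momentClass d k r := by
    refine twoPoint_mem_momentClass hk hr.le s ?_
    simp only [x, if_true, Bool.false_eq_true, if_false, norm_smul, he, mul_one, norm_zero,
      Real.norm_of_nonneg ha0.le, Real.zero_rpow hk0.ne', mul_zero, add_zero, ← hpa]
    exact mul_le_mul_of_nonneg_right hs (by positivity)
  have hmean (s : unitInterval) : meanOf (twoPoint s x) = ((s : ℝ) * a) • e := by
    rw [meanOf_twoPoint]; simp [x, smul_smul]
  have hnorm : ‖meanOf (twoPoint p x)‖ = p * a := by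
    rw [hmean, norm_smul, he, mul_one, Real.norm_of_nonneg (mul_nonneg p.2.1 ha0.le)]
  have hlow : ENNReal.ofReal (((p : ℝ) * a) ^ 2 / 8) ≤ maxRisk (momentClass d k r) meanOf est := by
    refine ofReal_le_of_mul_le_mul (c := 4) (by norm_num) ?_
    have h1 := h.le_risk_add_risk hβ hest p x (meanOf (twoPoint p x)) <| by
      have : 4 * (n * β) ≤ a := le_max_right _ _
      rw [hnorm]
      nlinarith [mul_le_mul_of_nonneg_left this p.2.1]
    have h2 := two_mul_maxRisk_ge (est := est) (θ := meanOf) (hmem 0 p.2.1) (hmem p le_rfl)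
    have h3 : meanOf (twoPoint 0 x) = 0 := by rw [hmean]; simp
    rw [h3] at h2
    rw [hnorm] at h1
    calc ENNReal.ofReal (4 * (((p : ℝ) * a) ^ 2 / 8))
        = ENNReal.ofReal (((p : ℝ) * a) ^ 2 / 2) := by congr 1; ring
      _ ≤ _ := h1
      _ ≤ 2 * (2 * maxRisk (momentClass d k r) meanOf est) := by gcongr
      _ = _ := by rw [← mul_assoc]; norm_num
  refine le_trans ?_ hlow
  -- If `a = r`, then `p = 1` and the branch `r^2` of the minimum is used; this covers `β = 0`.
  -- Otherwise `(p * a)^2 = r^(2k) / a^(2(k-1))`, and the `4` in `a` is the source of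
  -- `(1/4)^(2(k-1))`.
  rcases le_total (4 * (n * β)) r with hc | hc
  · have hp : (p : ℝ) * a = r := by
      have : a = r := max_eq_left hc
      rw [show (p : ℝ) = (r / a) ^ k from rfl, this, div_self hr.ne', Real.one_rpow, one_mul]
    have h4 : ((1 : ℝ) / 4) ^ (2 * (k - 1)) ≤ 1 :=
      Real.rpow_le_one (by norm_num) (by norm_num) (by linarith)
    rw [hp]
    calc _ ≤ ENNReal.ofReal (1 / 8) * ENNReal.ofReal r ^ 2 :=
          mul_le_mul' (ENNReal.ofReal_le_ofReal (by linarith)) (min_le_right _ _)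
      _ = _ := by
          rw [← ENNReal.ofReal_pow hr.le, ← ENNReal.ofReal_mul (by norm_num)]
          congr 1; ring
  · have hnβ : 0 < n * β := by linarith
    have haa : a = 4 * (n * β) := max_eq_right hc
    have hp : ((p : ℝ) * a) ^ 2 = r ^ (2 * k) / a ^ (2 * (k - 1)) := by
      rw [eq_div_iff (by positivity), mul_comm 2 (k - 1), mul_comm 2 k, Real.rpow_mul ha0.le,
        Real.rpow_mul hr.le, Real.rpow_two, Real.rpow_two, ← mul_pow, ← hpa,
        Real.rpow_sub ha0, Real.rpow_one]
      field_simp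
    rw [hp, haa]
    refine (mul_le_mul_right (min_le_left _ _) _).trans (le_of_eq ?_)
    rw [← ENNReal.ofReal_natCast, ← ENNReal.ofReal_mul (by positivity),
      ENNReal.ofReal_rpow_of_pos hnβ, ENNReal.ofReal_rpow_of_pos hr,
      ← ENNReal.ofReal_div_of_pos (by positivity), ← ENNReal.ofReal_mul (by positivity)]
    congr 1
    rw [Real.mul_rpow (by norm_num) hnβ.le, Real.div_rpow (by norm_num) (by norm_num),
      Real.one_rpow]
    field_simp

end WorstCaseLowerBound

/-! ### The score identity for coin flips. -/

section Score

variable {n : ℕ} {V : Type*} [NormedAddCommGroup V] [NormedSpace ℝ V]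

/-- The number of heads. -/
def headCount (A : Fin n → Bool) : ℝ := ∑ i, if A i then 1 else 0

lemma hasDerivAt_coinWeight (q : ℝ) (b : Bool) :
    HasDerivAt (fun s => coinWeight s b) (if b then 1 else -1) q := by
  cases b
  · simpa [coinWeight] using (hasDerivAt_id' q).const_sub 1
  · simpa [coinWeight] using hasDerivAt_id' q

/-- Each flip has logarithmic derivative `(1_head - q) / (q * (1 - q))`; the product rule adds them
up. -/
lemma hasDerivAt_flipsWeight {q : ℝ} (hq : q ∈ Set.Ioo (0 : ℝ) 1) (A : Fin n → Bool) :
    HasDerivAt (fun s => flipsWeight s A)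
      ((q * (1 - q))⁻¹ * (flipsWeight q A * (headCount A - n * q))) q := by
  have h0 : q ≠ 0 := hq.1.ne'
  have h1 : 1 - q ≠ 0 := (sub_pos.2 hq.2).ne'
  refine (HasDerivAt.fun_finsetProd fun i (_ : i ∈ Finset.univ) =>
    hasDerivAt_coinWeight q (A i)).congr_deriv ?_
  have hc : headCount A - n * q = ∑ i, ((if A i then (1 : ℝ) else 0) - q) := by
    simp [headCount, Finset.sum_sub_distrib]
  rw [hc, Finset.mul_sum, Finset.mul_sum]
  refine Finset.sum_congr rfl fun i hi => ?_
  rw [flipsWeight, ← Finset.mul_prod_erase _ _ hi, smul_eq_mul]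
  cases A i <;> simp [coinWeight] <;> field_simp

/-- Flip `j` is independent of the others, so it can be integrated out; this links `n + 1` flips
with `n`. -/
lemma sum_flipsWeight_removeNth (q : ℝ) (j : Fin (n + 1)) (g : Bool → (Fin n → Bool) → V) :
    ∑ D : Fin (n + 1) → Bool, flipsWeight q D • g (D j) (j.removeNth D)
      = ∑ A : Fin n → Bool, flipsWeight q A • (q • g true A + (1 - q) • g false A) := by
  rw [← (Fin.insertNthEquiv (fun _ => Bool) j).sum_comp, Fintype.sum_prod_type_right]
  refine Finset.sum_congr rfl fun A _ => ?_
  have h (b : Bool) : flipsWeight q (j.insertNth b A : Fin (n + 1) → Bool)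
      = coinWeight q b * flipsWeight q A := by
    simp [flipsWeight, Fin.prod_univ_succAbove _ j]
  have hg (b : Bool) : flipsWeight q (j.insertNth b A : Fin (n + 1) → Bool)
      • g ((j.insertNth b A : Fin (n + 1) → Bool) j)
        (j.removeNth (j.insertNth b A : Fin (n + 1) → Bool))
      = (coinWeight q b * flipsWeight q A) • g b A := by
    rw [h, Fin.insertNth_apply_same, Fin.removeNth_insertNth]
  refine (Finset.sum_congr rfl fun b _ => hg b).trans ?_
  simp only [Fintype.sum_bool, coinWeight, if_true, Bool.false_eq_true, if_false]
  module

lemma headCount_eq_removeNth (D : Fin (n + 1) → Bool) (j : Fin (n + 1)) :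
    headCount D = (if D j then 1 else 0) + headCount (j.removeNth D) :=
  Fin.sum_univ_succAbove _ j

/-- The score of coin flips is the mean effect of deleting a tail instead of a head. -/
lemma sum_score_eq_sum_removeNth (q : ℝ) (f : (Fin n → Bool) → V) :
    ((n : ℝ) + 1) • ∑ A : Fin n → Bool, (flipsWeight q A * (headCount A - n * q)) • f A
      = ∑ D : Fin (n + 1) → Bool, flipsWeight q D • ∑ i, ∑ j,
          (if D i = true ∧ D j = false then (1 : ℝ) else 0)
            • (f (j.removeNth D) - f (i.removeNth D)) := by
  -- Collects the coefficient of `f (j.removeNth D)`: if `D j` is a tail, the number of heads; if it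
  -- is a head, minus the number of tails. Both are written through `headCount` of the remaining `n`
  -- flips.
  have hD (D : Fin (n + 1) → Bool) :
      ∑ i, ∑ j, (if D i = true ∧ D j = false then (1 : ℝ) else 0)
          • (f (j.removeNth D) - f (i.removeNth D))
        = ∑ j, ((fun b A => (if b then (0 : ℝ) else headCount A) • f A) (D j) (j.removeNth D)
          - (fun b A => (if b then (n : ℝ) - headCount A else 0) • f A) (D j)
            (j.removeNth D)) := by
    simp only [smul_sub, Finset.sum_sub_distrib]
    congr 1
    · rw [Finset.sum_comm]
      refine Finset.sum_congr rfl fun j _ => ?_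
      rw [← Finset.sum_smul]
      congr 1
      cases hj : D j
      · have := headCount_eq_removeNth D j
        simp only [hj, Bool.false_eq_true, if_false, zero_add] at this
        simp only [and_true, Bool.false_eq_true, if_false]
        rw [← this, headCount]
      · simp
    · refine Finset.sum_congr rfl fun i _ => ?_
      rw [← Finset.sum_smul]
      congr 1
      cases hi : D i
      · simp
      · have h1 := headCount_eq_removeNth D i
        simp only [hi, if_true] at h1
        have h2 : ∑ j, (if D j = false then (1 : ℝ) else 0) = (n + 1 : ℝ) - headCount D := by
          rw [headCount, eq_sub_iff_add_eq, ← Finset.sum_add_distrib]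
          have (j : Fin (n + 1)) : (if D j = false then (1 : ℝ) else 0)
              + (if D j = true then 1 else 0) = 1 := by cases D j <;> simp
          simp [this]
        simp only [true_and, if_true, h2, h1]
        ring
  simp_rw [hD, Finset.smul_sum, smul_sub]
  rw [Finset.sum_comm]
  simp_rw [Finset.sum_sub_distrib]
  have key (j : Fin (n + 1)) := sum_flipsWeight_removeNth q j
    fun b A => (if b then (0 : ℝ) else headCount A) • f A
  have key' (j : Fin (n + 1)) := sum_flipsWeight_removeNth q j
    fun b A => (if b then (n : ℝ) - headCount A else 0) • f A
  rw [Finset.sum_congr rfl fun j _ => key j, Finset.sum_congr rfl fun j _ => key' j,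
    Finset.sum_const, Finset.sum_const, ← smul_sub, ← Finset.sum_sub_distrib,
    Finset.card_univ, Fintype.card_fin, ← Nat.cast_smul_eq_nsmul ℝ, ← Finset.smul_sum]
  push_cast
  congr 1
  -- Averaging over the deleted flip, with `h = headCount A`: `(1 - q) * h - q * (n - h) = h - n *
  -- q`. The `n + 1` positions give the factor on the left.
  refine Finset.sum_congr rfl fun A _ => ?_
  simp only [↓reduceIte]
  module

/-- For each pair of positions at most one of the two orders is (head, tail), hence the division by
`2`. -/
lemma norm_sum_removeNth_sub_le (f : (Fin n → Bool) → V) (D : Fin (n + 1) → Bool) :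
    ‖∑ i, ∑ j, (if D i = true ∧ D j = false then (1 : ℝ) else 0)
        • (f (j.removeNth D) - f (i.removeNth D))‖
      ≤ (∑ i : Fin (n + 1), ∑ j : Fin (n + 1), ‖f (i.removeNth D) - f (j.removeNth D)‖) / 2 := by
  set t : Fin (n + 1) → Fin (n + 1) → ℝ := fun i j => ‖f (i.removeNth D) - f (j.removeNth D)‖
  set u : Fin (n + 1) → Fin (n + 1) → ℝ := fun i j =>
    (if D i = true ∧ D j = false then (1 : ℝ) else 0) * t i j
  have h1 : ‖∑ i, ∑ j, (if D i = true ∧ D j = false then (1 : ℝ) else 0)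
      • (f (j.removeNth D) - f (i.removeNth D))‖ ≤ ∑ i, ∑ j, u i j := by
    refine norm_sum_le_of_le _ fun i _ => norm_sum_le_of_le _ fun j _ => ?_
    rw [norm_smul, norm_sub_rev, Real.norm_of_nonneg (by split_ifs <;> norm_num)]
  have h2 : ∑ i, ∑ j, u i j + ∑ i, ∑ j, u j i ≤ ∑ i, ∑ j, t i j := by
    simp_rw [← Finset.sum_add_distrib]
    refine Finset.sum_le_sum fun i _ => Finset.sum_le_sum fun j _ => ?_
    have ht : t j i = t i j := norm_sub_rev _ _
    have ht0 : 0 ≤ t i j := norm_nonneg _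
    simp only [u, ht]
    cases D i <;> cases D j <;> simp [ht0]
  rw [Finset.sum_comm (f := fun i j => u j i)] at h2
  linarith

/-- A function of coin flips that is stable under deletion has means that vary slowly with the
bias of the coin. -/
lemma norm_sum_flipsWeight_sub_le {β : ℝ} (f : (Fin n → Bool) → V)
    (hf : ∀ D : Fin (n + 1) → Bool,
      ∑ i : Fin (n + 1), ∑ j : Fin (n + 1), ‖f (i.removeNth D) - f (j.removeNth D)‖ ≤ ((n : ℝ) + 1) ^ 2 * β) :
    ‖∑ A, flipsWeight (3 / 4) A • f A - ∑ A, flipsWeight (1 / 4) A • f A‖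
      ≤ 4 / 3 * ((n + 1) * β) := by
  have hn : (0 : ℝ) < (n : ℝ) + 1 := by positivity
  have hβ : 0 ≤ β := by
    have h1 : 0 ≤ ((n : ℝ) + 1) ^ 2 * β := (Finset.sum_nonneg fun i _ =>
      Finset.sum_nonneg fun j _ => norm_nonneg _).trans (hf fun _ => true)
    exact nonneg_of_mul_nonneg_right h1 (by positivity)
  have hderiv (q : ℝ) (hq : q ∈ Set.Icc (1 / 4 : ℝ) (3 / 4)) :
      HasDerivAt (fun s => ∑ A : Fin n → Bool, flipsWeight s A • f A)
        ((q * (1 - q))⁻¹ •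
          ∑ A : Fin n → Bool, (flipsWeight q A * (headCount A - n * q)) • f A) q := by
    have hq' : q ∈ Set.Ioo (0 : ℝ) 1 := ⟨by linarith [hq.1], by linarith [hq.2]⟩
    refine (HasDerivAt.fun_sum fun A _ =>
      (hasDerivAt_flipsWeight hq' A).smul_const (f A)).congr_deriv ?_
    simp_rw [Finset.smul_sum, smul_smul]
  have hbound (q : ℝ) (hq : q ∈ Set.Icc (1 / 4 : ℝ) (3 / 4)) :
      ‖(q * (1 - q))⁻¹ • ∑ A : Fin n → Bool, (flipsWeight q A * (headCount A - n * q)) • f A‖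
        ≤ 8 / 3 * ((n + 1) * β) := by
    have hq' : q ∈ Set.Icc (0 : ℝ) 1 := ⟨by linarith [hq.1], by linarith [hq.2]⟩
    have hqq : 3 / 16 ≤ q * (1 - q) := by nlinarith [hq.1, hq.2]
    have h1 : ((n : ℝ) + 1) *
        ‖∑ A : Fin n → Bool, (flipsWeight q A * (headCount A - n * q)) • f A‖
          ≤ ((n : ℝ) + 1) ^ 2 * β / 2 := by
      rw [← Real.norm_of_nonneg hn.le, ← norm_smul, sum_score_eq_sum_removeNth,
        Real.norm_of_nonneg hn.le]
      calc _ ≤ ∑ D : Fin (n + 1) → Bool, flipsWeight q D * (((n : ℝ) + 1) ^ 2 * β / 2) := by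
            refine norm_sum_le_of_le _ fun D _ => ?_
            rw [norm_smul, Real.norm_of_nonneg (flipsWeight_nonneg hq' D)]
            refine mul_le_mul_of_nonneg_left ?_ (flipsWeight_nonneg hq' D)
            exact (norm_sum_removeNth_sub_le f D).trans (by linarith [hf D])
        _ = _ := by rw [← Finset.sum_mul, sum_flipsWeight, one_mul]
    have h2 : ‖∑ A : Fin n → Bool, (flipsWeight q A * (headCount A - n * q)) • f A‖
        ≤ ((n : ℝ) + 1) * β / 2 := by
      refine le_of_mul_le_mul_left (h1.trans_eq ?_) hn
      ring
    have h3 : (q * (1 - q))⁻¹ ≤ 16 / 3 := by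
      rw [inv_le_comm₀ (by linarith) (by norm_num)]; linarith
    have h4 : 0 ≤ (q * (1 - q))⁻¹ := inv_nonneg.2 (by linarith)
    rw [norm_smul, Real.norm_of_nonneg h4]
    calc _ ≤ 16 / 3 * (((n : ℝ) + 1) * β / 2) := mul_le_mul h3 h2 (norm_nonneg _) (by norm_num)
      _ = _ := by ring
  -- Mean value inequality on an interval of length `1/2`. It stays away from `0` and `1`, so that
  -- `q * (1 - q) ≥ 3/16`.
  have h := (convex_Icc (1 / 4 : ℝ) (3 / 4)).norm_image_sub_le_of_norm_hasDerivWithin_le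
    (fun q hq => (hderiv q hq).hasDerivWithinAt) hbound
    (show (1 / 4 : ℝ) ∈ Set.Icc (1 / 4) (3 / 4) by norm_num)
    (show (3 / 4 : ℝ) ∈ Set.Icc (1 / 4) (3 / 4) by norm_num)
  refine h.trans_eq ?_
  norm_num
  ring

end Score

/-! ### Averaging out the seed; bias versus risk. -/

section AverageCaseLowerBound

variable {X E : Type*} [NormedAddCommGroup E] {n : ℕ}

/-- AM-GM, turning a first-order error into a squared one. It is used with `c = r`, so the price
`c^2 / 8` is a small part of the squared separation. -/
lemma ofReal_mul_enorm_le {c : ℝ} (hc : 0 ≤ c) (y : E) :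
    ENNReal.ofReal c * ‖y‖ₑ ≤ ENNReal.ofReal (c ^ 2 / 8) + 2 * ‖y‖ₑ ^ 2 := by
  have h : c * ‖y‖ ≤ c ^ 2 / 8 + 2 * ‖y‖ ^ 2 := by nlinarith [sq_nonneg (c / 4 - ‖y‖)]
  have h2 := ENNReal.ofReal_le_ofReal h
  rw [ENNReal.ofReal_add (by positivity) (by positivity), ENNReal.ofReal_mul hc,
    ENNReal.ofReal_mul zero_le_two, ENNReal.ofReal_pow (norm_nonneg _)] at h2
  simpa using h2

/-- The output of an estimator, averaged over the seed. -/
def seedMean [NormedSpace ℝ E] (est : Estimator n X E) (D : Fin n → X) : E := ∫ ξ, est D ξ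

lemma ofReal_mul_enorm_seedMean_sub_le [NormedSpace ℝ E] [CompleteSpace E] {est : Estimator n X E} {D : Fin n → X} {t : E} {c : ℝ}
    (hc : 0 ≤ c) (hi : Integrable (est D)) :
    ENNReal.ofReal c * ‖seedMean est D - t‖ₑ
      ≤ ENNReal.ofReal (c ^ 2 / 8) + 2 * seedRisk est D t := by
  have h1 : seedMean est D - t = ∫ ξ, (est D ξ - t) := by
    rw [integral_sub hi (integrable_const t)]; simp [seedMean]
  rw [h1, seedRisk, ← lintegral_const_mul' _ _ ENNReal.ofNat_ne_top]
  calc _ ≤ ENNReal.ofReal c * ∫⁻ ξ, ‖est D ξ - t‖ₑ := by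
        gcongr; exact enorm_integral_le_lintegral_enorm _
    _ = ∫⁻ ξ, ENNReal.ofReal c * ‖est D ξ - t‖ₑ :=
        (lintegral_const_mul' _ _ ENNReal.ofReal_ne_top).symm
    _ ≤ ∫⁻ ξ, (ENNReal.ofReal (c ^ 2 / 8) + 2 * ‖est D ξ - t‖ₑ ^ 2) :=
        lintegral_mono fun ξ => ofReal_mul_enorm_le hc _
    _ = _ := by rw [lintegral_add_left measurable_const]; simp

/-- Averaging over the seed preserves stability, so the score argument can be applied to a
deterministic function of the flips. Integrability matters: `seedMean` would otherwise take the
default value `0`. -/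
lemma IsLpStable.sum_norm_seedMean_sub_le [NormedSpace ℝ E] {β : ℝ} (hβ : 0 ≤ β) {est : Estimator n X E}
    (h : IsLpStable 1 β est) (x : Bool → X)
    (hi : ∀ A : Fin n → Bool, Integrable (est (x ∘ A))) (D : Fin (n + 1) → Bool) :
    ∑ i : Fin (n + 1), ∑ j : Fin (n + 1),
        ‖seedMean est (x ∘ i.removeNth D) - seedMean est (x ∘ j.removeNth D)‖
      ≤ ((n : ℝ) + 1) ^ 2 * β := by
  rw [IsLpStable, if_neg ENNReal.one_ne_top] at h
  simp only [ENNReal.toReal_one, div_one, ENNReal.rpow_one] at h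
  have h0 : ((n : ℝ≥0∞) + 1) ^ 2 ≠ 0 := by simp
  have ht : ((n : ℝ≥0∞) + 1) ^ 2 ≠ ∞ := by finiteness
  rw [← ENNReal.div_eq_inv_mul, ENNReal.div_le_iff' h0 ht] at h
  have h1 := (le_iSup (fun D : Fin (n + 1) → X => ∑ i : Fin (n + 1), ∑ j : Fin (n + 1),
    ∫⁻ ξ, ‖est (i.removeNth D) ξ - est (j.removeNth D) ξ‖ₑ) (x ∘ D)).trans h
  rw [← ENNReal.ofReal_le_ofReal_iff (by positivity), ENNReal.ofReal_mul (by positivity)]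
  have hc : ENNReal.ofReal (((n : ℝ) + 1) ^ 2) = ((n : ℝ≥0∞) + 1) ^ 2 := by
    rw [ENNReal.ofReal_pow (by positivity), ENNReal.ofReal_add (by positivity) zero_le_one]
    simp
  rw [hc]
  refine le_trans ?_ h1
  rw [ENNReal.ofReal_sum_of_nonneg fun i _ => Finset.sum_nonneg fun j _ => norm_nonneg _]
  refine Finset.sum_le_sum fun i _ => ?_
  rw [ENNReal.ofReal_sum_of_nonneg fun j _ => norm_nonneg _]
  refine Finset.sum_le_sum fun j _ => ?_
  rw [ofReal_norm, seedMean, seedMean, ← integral_sub (hi _) (hi _)]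
  exact enorm_integral_le_lintegral_enorm _

variable [MeasurableSpace X] [MeasurableSpace E] [BorelSpace E]

lemma integrable_seed_of_seedRisk_ne_top [SecondCountableTopology E] {est : Estimator n X E}
    (hest : IsMeasurableEstimator est) {D : Fin n → X} {t : E} (h : seedRisk est D t ≠ ∞) :
    Integrable (est D) := by
  have h1 : Integrable fun ξ => est D ξ - t := by
    refine ⟨((hest.measurable_seed D).sub_const t).aestronglyMeasurable, ?_⟩
    rw [HasFiniteIntegral]
    have h2 (ξ : unitInterval) : ‖est D ξ - t‖ₑ
        ≤ ENNReal.ofReal (1 ^ 2 / 8) + 2 * ‖est D ξ - t‖ₑ ^ 2 := by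
      simpa using ofReal_mul_enorm_le zero_le_one (est D ξ - t)
    refine (lintegral_mono h2).trans_lt ?_
    rw [lintegral_add_left measurable_const, lintegral_const_mul' _ _ ENNReal.ofNat_ne_top]
    exact ENNReal.add_lt_top.2 ⟨by simp, ENNReal.mul_lt_top (by simp) h.lt_top⟩
  refine (h1.add (integrable_const t)).congr (Filter.Eventually.of_forall fun ξ => ?_)
  simp

lemma ofReal_mul_enorm_bias_le [NormedSpace ℝ E] [CompleteSpace E] {est : Estimator n X E} (hest : IsMeasurableEstimator est)
    {c : ℝ} (hc : 0 ≤ c) (q : unitInterval) (x : Bool → X) (t : E)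
    (hi : ∀ A : Fin n → Bool, Integrable (est (x ∘ A))) :
    ENNReal.ofReal c * ‖∑ A, flipsWeight q A • seedMean est (x ∘ A) - t‖ₑ
      ≤ ENNReal.ofReal (c ^ 2 / 8) + 2 * risk (twoPoint q x) t est := by
  have hW : ∑ A : Fin n → Bool, ENNReal.ofReal (flipsWeight q A) = 1 := by
    rw [← ENNReal.ofReal_sum_of_nonneg fun A _ => flipsWeight_nonneg q.2 A, sum_flipsWeight,
      ENNReal.ofReal_one]
  have h1 : ∑ A, flipsWeight q A • seedMean est (x ∘ A) - t
      = ∑ A, flipsWeight q A • (seedMean est (x ∘ A) - t) := by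
    simp_rw [smul_sub, Finset.sum_sub_distrib]
    rw [← Finset.sum_smul, sum_flipsWeight, one_smul]
  calc _ ≤ ENNReal.ofReal c * ∑ A : Fin n → Bool,
        ENNReal.ofReal (flipsWeight q A) * ‖seedMean est (x ∘ A) - t‖ₑ := by
        rw [h1]
        gcongr
        refine (enorm_sum_le _ _).trans (le_of_eq (Finset.sum_congr rfl fun A _ => ?_))
        rw [enorm_smul, Real.enorm_of_nonneg (flipsWeight_nonneg q.2 A)]
    _ = ∑ A : Fin n → Bool, ENNReal.ofReal (flipsWeight q A) *
        (ENNReal.ofReal c * ‖seedMean est (x ∘ A) - t‖ₑ) := by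
        rw [Finset.mul_sum]; exact Finset.sum_congr rfl fun A _ => by ring
    _ ≤ ∑ A : Fin n → Bool, ENNReal.ofReal (flipsWeight q A) *
        (ENNReal.ofReal (c ^ 2 / 8) + 2 * seedRisk est (x ∘ A) t) :=
        Finset.sum_le_sum fun A _ =>
          mul_le_mul_right (ofReal_mul_enorm_seedMean_sub_le hc (hi A)) _
    _ = _ := by
        simp_rw [mul_add, Finset.sum_add_distrib]
        rw [← Finset.sum_mul, hW, one_mul, risk_twoPoint hest, Finset.mul_sum]
        congr 1
        exact Finset.sum_congr rfl fun A _ => by ring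

end AverageCaseLowerBound

/-! ### Lower bound under average-case stability. -/

section AverageCaseRate

variable {d n : ℕ} {k r β : ℝ}

/-- Below the critical stability level, an average-case stable estimator is no better than a
constant. -/
theorem IsLpStable.le_maxRisk (hd : 1 ≤ d) (hn : 1 ≤ n) (hk : 1 ≤ k) (hr : 0 < r) (hβ : 0 ≤ β)
    (hβr : β ≤ r / (10 * n))
    {est : Estimator n (EuclideanSpace ℝ (Fin d)) (EuclideanSpace ℝ (Fin d))}
    (hest : IsMeasurableEstimator est) (h : IsLpStable 1 β est) :
    ENNReal.ofReal (1 / 32) * ENNReal.ofReal r ^ 2 ≤ maxRisk (momentClass d k r) meanOf est := by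
  have hn' : (1 : ℝ) ≤ n := by exact_mod_cast hn
  by_cases htop : maxRisk (momentClass d k r) meanOf est = ∞
  · rw [htop]; exact le_top
  obtain ⟨e, he⟩ := exists_norm_eq_one hd
  let p : unitInterval := ⟨1 / 4, by norm_num, by norm_num⟩
  let q : unitInterval := ⟨3 / 4, by norm_num, by norm_num⟩
  let x : Bool → EuclideanSpace ℝ (Fin d) := fun b => if b then r • e else -(r • e)
  have hx (b : Bool) : ‖x b‖ = r := by cases b <;> simp [x, norm_smul, he, abs_of_pos hr]
  have hmem (s : unitInterval) : twoPoint s x ∈ momentClass d k r :=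
    twoPoint_mem_momentClass hk hr.le s (by rw [hx, hx]; linarith)
  -- Every sequence of flips has positive probability at bias `3/4`, so finite maximal risk gives
  -- finite `seedRisk` on each sample.
  have hi (A : Fin n → Bool) : Integrable (est (x ∘ A)) := by
    refine integrable_seed_of_seedRisk_ne_top hest (t := meanOf (twoPoint q x)) fun hA => htop ?_
    have h1 : risk (twoPoint q x) (meanOf (twoPoint q x)) est = ∞ := by
      rw [risk_twoPoint hest, ENNReal.sum_eq_top]
      refine ⟨A, Finset.mem_univ A, ?_⟩
      rw [hA, ENNReal.mul_top]
      have : 0 < flipsWeight (q : ℝ) A := Finset.prod_pos fun i _ => by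
        cases A i <;> norm_num [coinWeight, q]
      simpa using this
    exact top_le_iff.1 (h1.symm.le.trans (le_iSup₂_of_le _ (hmem q) le_rfl))
  set f : (Fin n → Bool) → EuclideanSpace ℝ (Fin d) := fun A => seedMean est (x ∘ A)
  have hmove := norm_sum_flipsWeight_sub_le f (h.sum_norm_seedMean_sub_le hβ x hi)
  set hp := ∑ A, flipsWeight (1 / 4) A • f A
  set hq := ∑ A, flipsWeight (3 / 4) A • f A
  have bp : ENNReal.ofReal r * ‖hp - meanOf (twoPoint p x)‖ₑ ≤ _ :=
    ofReal_mul_enorm_bias_le hest hr.le p x (meanOf (twoPoint p x)) hi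
  have bq : ENNReal.ofReal r * ‖hq - meanOf (twoPoint q x)‖ₑ ≤ _ :=
    ofReal_mul_enorm_bias_le hest hr.le q x (meanOf (twoPoint q x)) hi
  have hsep : ‖meanOf (twoPoint q x) - meanOf (twoPoint p x)‖ = r := by
    rw [meanOf_twoPoint, meanOf_twoPoint]
    have : (q : ℝ) • x true + (1 - q : ℝ) • x false - ((p : ℝ) • x true + (1 - p : ℝ) • x false)
        = r • e := by
      simp only [p, q, x, if_true, Bool.false_eq_true, if_false]
      module
    rw [this, norm_smul, he, mul_one, Real.norm_of_nonneg hr.le]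
  -- From `n + 1 ≤ 2n`: `4/3 * 2n * r/(10n) = 4r/15`.
  have hmove' : ‖hq - hp‖ ≤ 4 / 15 * r := by
    refine hmove.trans ?_
    have h1 : β * (10 * n) ≤ r := (le_div_iff₀ (by positivity)).1 hβr
    nlinarith
  have htri : r * (11 / 15 * r) ≤ r * ‖hp - meanOf (twoPoint p x)‖
      + r * ‖hq - meanOf (twoPoint q x)‖ := by
    rw [← mul_add]
    refine mul_le_mul_of_nonneg_left ?_ hr.le
    have h1 : ‖meanOf (twoPoint q x) - meanOf (twoPoint p x)‖
        ≤ ‖hp - meanOf (twoPoint p x)‖ + ‖hq - meanOf (twoPoint q x)‖ + ‖hq - hp‖ := by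
      calc _ = ‖(hp - meanOf (twoPoint p x)) - (hq - meanOf (twoPoint q x)) + (hq - hp)‖ := by
            congr 1; abel
        _ ≤ _ := (norm_add_le _ _).trans (add_le_add_left (norm_sub_le _ _) _)
    linarith
  have hfin := ENNReal.ofReal_le_ofReal htri
  rw [ENNReal.ofReal_add (by positivity) (by positivity), ENNReal.ofReal_mul hr.le (q := ‖_‖),
    ENNReal.ofReal_mul hr.le (q := ‖_‖), ofReal_norm, ofReal_norm] at hfin
  have h2 := two_mul_maxRisk_ge (est := est) (θ := meanOf) (hmem p) (hmem q)
  -- `11/15 = 1 - 4/15` is what the two biases must cover; two AM-GM costs of `r^2 / 8` leave `11/15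
  -- - 1/4 = 29/60`.
  have h3 : ENNReal.ofReal (r ^ 2 / 4) + ENNReal.ofReal (29 / 60 * r ^ 2)
      ≤ ENNReal.ofReal (r ^ 2 / 4) + ENNReal.ofReal 4 * maxRisk (momentClass d k r) meanOf est := by
    rw [← ENNReal.ofReal_add (by positivity) (by positivity)]
    calc ENNReal.ofReal (r ^ 2 / 4 + 29 / 60 * r ^ 2)
        = ENNReal.ofReal (r * (11 / 15 * r)) := by congr 1; ring
      _ ≤ _ := hfin.trans (add_le_add bp bq)
      _ = (ENNReal.ofReal (r ^ 2 / 8) + ENNReal.ofReal (r ^ 2 / 8))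
          + 2 * (risk (twoPoint p x) (meanOf (twoPoint p x)) est
            + risk (twoPoint q x) (meanOf (twoPoint q x)) est) := by ring
      _ ≤ (ENNReal.ofReal (r ^ 2 / 8) + ENNReal.ofReal (r ^ 2 / 8))
          + 2 * (2 * maxRisk (momentClass d k r) meanOf est) := by gcongr
      _ = _ := by
          rw [← ENNReal.ofReal_add (by positivity) (by positivity), ← mul_assoc]
          congr 2
          · ring
          · norm_num
  rw [← ENNReal.ofReal_pow hr.le, ← ENNReal.ofReal_mul (by norm_num)]
  refine ofReal_le_of_mul_le_mul (c := 4) (by norm_num) (le_trans (ENNReal.ofReal_le_ofReal ?_)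
    ((ENNReal.add_le_add_iff_left ENNReal.ofReal_ne_top).1 h3))
  nlinarith [sq_nonneg r]

end AverageCaseRate

/-! ### Variance of empirical means. -/

section Variance

open ProbabilityTheory

variable {X : Type*} [MeasurableSpace X] {n d : ℕ}

/-- The variance of an empirical mean is at most the second moment divided by the sample size. -/
lemma lintegral_empiricalMean_sub_sq_le_real (hn : 1 ≤ n) (P : Measure X) [IsProbabilityMeasure P]
    {g : X → ℝ} (hg : Measurable g) :
    ∫⁻ D, ‖(n : ℝ)⁻¹ • ∑ i, g (D i) - ∫ x, g x ∂P‖ₑ ^ 2 ∂(Measure.pi fun _ : Fin n => P)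
      ≤ (n : ℝ≥0∞)⁻¹ * ∫⁻ x, ‖g x‖ₑ ^ 2 ∂P := by
  have hn0 : (n : ℝ) ≠ 0 := by positivity
  by_cases htop : ∫⁻ x, ‖g x‖ₑ ^ 2 ∂P = ∞
  · rw [htop, ENNReal.mul_top (by simp)]; exact le_top
  have hL : MemLp g 2 P := by
    refine ⟨hg.aestronglyMeasurable, ?_⟩
    rw [eLpNorm_lt_top_iff_lintegral_rpow_enorm_lt_top (by simp) (by simp)]
    simpa using Ne.lt_top htop
  have hL' : MemLp (fun x => (n : ℝ)⁻¹ * g x) 2 P := hL.const_mul _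
  have hi : Integrable g P := hL.integrable (by norm_num)
  have hvar := variance_sum_pi (μ := fun _ : Fin n => P)
    (X := fun _ x => (n : ℝ)⁻¹ * g x) fun _ => hL'
  have hsum : (∑ i : Fin n, fun D : Fin n → X => (n : ℝ)⁻¹ * g (D i))
      = fun D => (n : ℝ)⁻¹ • ∑ i, g (D i) := by
    ext D; simp [Finset.mul_sum]
  rw [hsum, variance_const_mul, Finset.sum_const, Finset.card_univ, Fintype.card_fin,
    nsmul_eq_mul] at hvar
  have hLi (i : Fin n) : MemLp (fun D : Fin n → X => g (D i)) 2 (Measure.pi fun _ => P) :=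
    hL.comp_measurePreserving (measurePreserving_eval (fun _ : Fin n => P) i)
  have hLs : MemLp (fun D : Fin n → X => (n : ℝ)⁻¹ • ∑ i, g (D i)) 2 (Measure.pi fun _ => P) :=
    (memLp_finsetSum Finset.univ fun i _ => hLi i).const_smul (n : ℝ)⁻¹
  have hmean : ∫ D, (n : ℝ)⁻¹ • ∑ i, g (D i) ∂(Measure.pi fun _ : Fin n => P)
      = ∫ x, g x ∂P := by
    rw [integral_smul, integral_finsetSum _ fun i _ => (hLi i).integrable (by norm_num)]
    have (i : Fin n) : ∫ D, g (D i) ∂(Measure.pi fun _ : Fin n => P) = ∫ x, g x ∂P :=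
      integral_comp_eval (μ := fun _ : Fin n => P) hg.aestronglyMeasurable
    simp [this, hn0]
  have hev := hLs.ofReal_variance_eq
  rw [evariance, hmean] at hev
  rw [← hev, hvar]
  have hsq : ENNReal.ofReal (∫ x, g x ^ 2 ∂P) = ∫⁻ x, ‖g x‖ₑ ^ 2 ∂P := by
    rw [ofReal_integral_eq_lintegral_ofReal hL.integrable_sq
      (Filter.Eventually.of_forall fun x => sq_nonneg _)]
    refine lintegral_congr fun x => ?_
    rw [← sq_abs, ENNReal.ofReal_pow (abs_nonneg _), ← Real.norm_eq_abs, ofReal_norm]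
  rw [← hsq, ← ENNReal.ofReal_natCast, ← ENNReal.ofReal_inv_of_pos (by positivity),
    ← ENNReal.ofReal_mul (by positivity)]
  refine ENNReal.ofReal_le_ofReal ?_
  have h1 : Var[g; P] ≤ ∫ x, g x ^ 2 ∂P := variance_le_expectation_sq hg.aestronglyMeasurable
  calc (n : ℝ) * ((n : ℝ)⁻¹ ^ 2 * Var[g; P]) = (n : ℝ)⁻¹ * Var[g; P] := by field_simp
    _ ≤ _ := by gcongr

lemma enorm_sq_eq_sum (v : EuclideanSpace ℝ (Fin d)) : ‖v‖ₑ ^ 2 = ∑ j, ‖v j‖ₑ ^ 2 := by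
  rw [← ofReal_norm, ← ENNReal.ofReal_pow (norm_nonneg _), EuclideanSpace.norm_sq_eq,
    ENNReal.ofReal_sum_of_nonneg fun _ _ => sq_nonneg _]
  refine Finset.sum_congr rfl fun j _ => ?_
  rw [ENNReal.ofReal_pow (norm_nonneg _), ofReal_norm]

/-- Squared Euclidean norms add over coordinates on both sides, so the dimension does not enter. -/
lemma lintegral_empiricalMean_sub_sq_le (hn : 1 ≤ n) (P : Measure X) [IsProbabilityMeasure P]
    {g : X → EuclideanSpace ℝ (Fin d)} (hg : Measurable g) :
    ∫⁻ D, ‖(n : ℝ)⁻¹ • ∑ i, g (D i) - ∫ x, g x ∂P‖ₑ ^ 2 ∂(Measure.pi fun _ : Fin n => P)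
      ≤ (n : ℝ≥0∞)⁻¹ * ∫⁻ x, ‖g x‖ₑ ^ 2 ∂P := by
  by_cases htop : ∫⁻ x, ‖g x‖ₑ ^ 2 ∂P = ∞
  · rw [htop, ENNReal.mul_top (by simp)]; exact le_top
  have hL : MemLp g 2 P := by
    refine ⟨hg.aestronglyMeasurable, ?_⟩
    rw [eLpNorm_lt_top_iff_lintegral_rpow_enorm_lt_top (by simp) (by simp)]
    simpa using Ne.lt_top htop
  have hi : Integrable g P := hL.integrable (by norm_num)
  have hgj (j : Fin d) : Measurable fun x => g x j := by fun_prop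
  have hcoord (j : Fin d) : (∫ x, g x ∂P) j = ∫ x, g x j ∂P :=
    ((EuclideanSpace.proj (𝕜 := ℝ) j).integral_comp_comm hi).symm
  simp_rw [enorm_sq_eq_sum]
  rw [lintegral_finsetSum _ fun j _ => by fun_prop, lintegral_finsetSum _ fun j _ => by fun_prop,
    Finset.mul_sum]
  refine Finset.sum_le_sum fun j _ => ?_
  have := lintegral_empiricalMean_sub_sq_le_real hn P (hgj j)
  simpa [hcoord] using this

end Variance

/-! ### Bias and second moment of truncated variables. -/

section Truncation

variable {d n : ℕ} {k r : ℝ} {ρ : ℝ≥0∞}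

lemma measurable_truncate : Measurable (truncate (d := d) ρ) :=
  measurable_id.indicator (measurableSet_le measurable_enorm measurable_const)

lemma truncate_of_le {x : EuclideanSpace ℝ (Fin d)} (h : ‖x‖ₑ ≤ ρ) : truncate ρ x = x := by
  rw [truncate, Set.indicator_of_mem (by exact h), id]

lemma truncate_of_lt {x : EuclideanSpace ℝ (Fin d)} (h : ρ < ‖x‖ₑ) : truncate ρ x = 0 := by
  rw [truncate, Set.indicator_of_notMem (by exact not_le.2 h)]

lemma enorm_truncate_le (x : EuclideanSpace ℝ (Fin d)) : ‖truncate ρ x‖ₑ ≤ ‖x‖ₑ := by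
  rcases le_or_gt ‖x‖ₑ ρ with h | h
  · rw [truncate_of_le h]
  · rw [truncate_of_lt h]; simp

lemma enorm_truncate_le_level (x : EuclideanSpace ℝ (Fin d)) : ‖truncate ρ x‖ₑ ≤ ρ := by
  rcases le_or_gt ‖x‖ₑ ρ with h | h
  · rwa [truncate_of_le h]
  · rw [truncate_of_lt h]; simp

lemma enorm_sub_truncate_le (x : EuclideanSpace ℝ (Fin d)) : ‖x - truncate ρ x‖ₑ ≤ ‖x‖ₑ := by
  rcases le_or_gt ‖x‖ₑ ρ with h | h
  · rw [truncate_of_le h]; simp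
  · rw [truncate_of_lt h, sub_zero]

/-- The difference is nonzero only where `‖x‖ > ρ`. The product form avoids dividing by a level that
may be `0` or `∞`. -/
lemma enorm_sub_truncate_mul_le (hk : 1 ≤ k) (x : EuclideanSpace ℝ (Fin d)) :
    ‖x - truncate ρ x‖ₑ * ρ ^ (k - 1) ≤ ‖x‖ₑ ^ k := by
  rcases le_or_gt ‖x‖ₑ ρ with h | h
  · rw [truncate_of_le h]; simp
  · have h0 : ‖x‖ₑ ≠ 0 := (pos_of_gt h).ne'
    rw [truncate_of_lt h, sub_zero]
    calc ‖x‖ₑ * ρ ^ (k - 1) ≤ ‖x‖ₑ ^ (1 : ℝ) * ‖x‖ₑ ^ (k - 1) := by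
          rw [ENNReal.rpow_one]
          gcongr
      _ = ‖x‖ₑ ^ k := by rw [← ENNReal.rpow_add _ _ h0 (by simp)]; congr 1; ring

lemma enorm_truncate_sq_le (hk2 : k ≤ 2) (x : EuclideanSpace ℝ (Fin d)) :
    ‖truncate ρ x‖ₑ ^ 2 ≤ ρ ^ (2 - k) * ‖x‖ₑ ^ k := by
  rcases le_or_gt ‖x‖ₑ ρ with h | h
  · rw [truncate_of_le h]
    rcases eq_or_ne ‖x‖ₑ 0 with h0 | h0
    · rw [h0]; simp
    · calc ‖x‖ₑ ^ 2 = ‖x‖ₑ ^ (2 - k) * ‖x‖ₑ ^ k := by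
            rw [← ENNReal.rpow_add _ _ h0 (by simp), ← ENNReal.rpow_two]; congr 1; ring
        _ ≤ _ := by gcongr
  · rw [truncate_of_lt h]; simp

/-- Second moment of the truncated variable. -/
def truncatedSecondMoment (P : ProbabilityMeasure (EuclideanSpace ℝ (Fin d))) (ρ : ℝ≥0∞) : ℝ≥0∞ :=
  ∫⁻ x, ‖truncate ρ x‖ₑ ^ 2 ∂(P : Measure (EuclideanSpace ℝ (Fin d)))

/-- A bound on the bias caused by truncation. -/
def truncationBias (P : ProbabilityMeasure (EuclideanSpace ℝ (Fin d))) (ρ : ℝ≥0∞) : ℝ≥0∞ :=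
  ∫⁻ x, ‖x - truncate ρ x‖ₑ ∂(P : Measure (EuclideanSpace ℝ (Fin d)))

variable {P : ProbabilityMeasure (EuclideanSpace ℝ (Fin d))}

lemma lintegral_rpow_le_of_mem {s : ℝ} (hs : 0 < s) (hsk : s ≤ k) (hP : P ∈ momentClass d k r) :
    ∫⁻ x, ‖x‖ₑ ^ s ∂(P : Measure (EuclideanSpace ℝ (Fin d))) ≤ ENNReal.ofReal r ^ s := by
  have h := eLpNorm'_le_eLpNorm'_of_exponent_le (μ := (P : Measure (EuclideanSpace ℝ (Fin d))))
    (f := id) hs hsk aestronglyMeasurable_id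
  rw [← ENNReal.rpow_inv_le_iff hs, ← one_div]
  exact h.trans hP

lemma lintegral_enorm_le_of_mem (hk : 1 ≤ k) (hP : P ∈ momentClass d k r) :
    ∫⁻ x, ‖x‖ₑ ∂(P : Measure (EuclideanSpace ℝ (Fin d))) ≤ ENNReal.ofReal r := by
  simpa using lintegral_rpow_le_of_mem one_pos hk hP

lemma integrable_id_of_mem (hk : 1 ≤ k) (hP : P ∈ momentClass d k r) :
    Integrable (fun x => x) (P : Measure (EuclideanSpace ℝ (Fin d))) :=
  ⟨aestronglyMeasurable_id, (lintegral_enorm_le_of_mem hk hP).trans_lt ENNReal.ofReal_lt_top⟩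

lemma integrable_truncate_of_mem (hk : 1 ≤ k) (hP : P ∈ momentClass d k r) :
    Integrable (truncate ρ) (P : Measure (EuclideanSpace ℝ (Fin d))) :=
  ⟨measurable_truncate.aestronglyMeasurable, (lintegral_mono enorm_truncate_le).trans_lt
    ((lintegral_enorm_le_of_mem hk hP).trans_lt ENNReal.ofReal_lt_top)⟩

lemma enorm_meanOf_le (hk : 1 ≤ k) (hP : P ∈ momentClass d k r) :
    ‖meanOf P‖ₑ ≤ ENNReal.ofReal r :=
  (enorm_integral_le_lintegral_enorm _).trans (lintegral_enorm_le_of_mem hk hP)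

lemma truncationBias_le (hk : 1 ≤ k) (hP : P ∈ momentClass d k r) :
    truncationBias P ρ ≤ ENNReal.ofReal r :=
  (lintegral_mono enorm_sub_truncate_le).trans (lintegral_enorm_le_of_mem hk hP)

lemma truncationBias_mul_le (hk : 1 ≤ k) (hP : P ∈ momentClass d k r) :
    truncationBias P ρ * ρ ^ (k - 1) ≤ ENNReal.ofReal r ^ k := by
  have hm : Measurable fun x : EuclideanSpace ℝ (Fin d) => ‖x - truncate ρ x‖ₑ :=
    (measurable_id.sub measurable_truncate).enorm
  rw [truncationBias, ← lintegral_mul_const _ hm]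
  exact (lintegral_mono fun x => enorm_sub_truncate_mul_le hk x).trans
    (lintegral_rpow_le_of_mem (by linarith) le_rfl hP)

lemma truncationBias_top : truncationBias P ∞ = 0 := by
  simp [truncationBias, truncate_of_le]

lemma enorm_integral_truncate_sub_meanOf_le (hk : 1 ≤ k) (hP : P ∈ momentClass d k r) :
    ‖∫ x, truncate ρ x ∂(P : Measure (EuclideanSpace ℝ (Fin d))) - meanOf P‖ₑ
      ≤ truncationBias P ρ := by
  rw [meanOf, ← enorm_neg, neg_sub,
    ← integral_sub (integrable_id_of_mem hk hP) (integrable_truncate_of_mem hk hP)]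
  exact enorm_integral_le_lintegral_enorm _

lemma min_one_two_mul_eq_of_two_le (hk : 2 ≤ k) : min 1 (2 * (1 - 1 / k)) = 1 := by
  rw [min_eq_left]
  have : 1 / k ≤ 1 / 2 := one_div_le_one_div_of_le (by norm_num) hk
  linarith

lemma min_one_two_mul_eq_of_le_two (hk : 1 ≤ k) (hk2 : k ≤ 2) :
    min 1 (2 * (1 - 1 / k)) = 2 * (1 - 1 / k) := by
  rw [min_eq_right]
  have : 1 / 2 ≤ 1 / k := one_div_le_one_div_of_le (by linarith) hk2
  linarith

/-- For `k ≥ 2` the second moment is at most `r^2` at any level. For `k < 2` it is at most `ρ^(2-k)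
* r^k ≤ r^2 * n^(2/k - 1)`. -/
lemma truncatedSecondMoment_le_freeRate (hn : 1 ≤ n) (hk : 1 ≤ k) (hr : 0 < r)
    (hP : P ∈ momentClass d k r)
    (hρ : k < 2 → ρ ≤ ENNReal.ofReal r * (n : ℝ≥0∞) ^ (1 / k)) :
    (n : ℝ≥0∞)⁻¹ * truncatedSecondMoment P ρ ≤ freeRate k r n := by
  have hR0 : ENNReal.ofReal r ≠ 0 := by simpa using hr
  have hn0 : (n : ℝ≥0∞) ≠ 0 := by simp; omega
  have hk0 : 0 < k := by linarith
  rcases le_or_gt 2 k with hk2 | hk2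
  · rw [freeRate, min_one_two_mul_eq_of_two_le hk2, ENNReal.rpow_one, ENNReal.div_eq_inv_mul]
    gcongr
    calc truncatedSecondMoment P ρ
        ≤ ∫⁻ x, ‖x‖ₑ ^ (2 : ℝ) ∂(P : Measure (EuclideanSpace ℝ (Fin d))) :=
          lintegral_mono fun x => by
            rw [ENNReal.rpow_two]
            exact pow_le_pow_left' (enorm_truncate_le x) 2
      _ ≤ ENNReal.ofReal r ^ (2 : ℝ) := lintegral_rpow_le_of_mem two_pos hk2 hP
      _ = _ := ENNReal.rpow_two _
  · rw [freeRate, min_one_two_mul_eq_of_le_two hk hk2.le]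
    have h1 : truncatedSecondMoment P ρ
        ≤ (ENNReal.ofReal r * (n : ℝ≥0∞) ^ (1 / k)) ^ (2 - k) * ENNReal.ofReal r ^ k := by
      calc truncatedSecondMoment P ρ
          ≤ ∫⁻ x, ρ ^ (2 - k) * ‖x‖ₑ ^ k ∂(P : Measure (EuclideanSpace ℝ (Fin d))) :=
            lintegral_mono fun x => enorm_truncate_sq_le hk2.le x
        _ = ρ ^ (2 - k) * ∫⁻ x, ‖x‖ₑ ^ k ∂(P : Measure (EuclideanSpace ℝ (Fin d))) :=
            lintegral_const_mul _ (by fun_prop)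
        _ ≤ _ := by
            gcongr
            · exact hρ hk2
            · exact lintegral_rpow_le_of_mem hk0 le_rfl hP
    refine (mul_le_mul_right h1 _).trans (le_of_eq ?_)
    rw [ENNReal.mul_rpow_of_nonneg _ _ (by linarith), ← ENNReal.rpow_mul, ENNReal.div_eq_inv_mul,
      ← ENNReal.rpow_neg, ← ENNReal.rpow_neg_one]
    calc (n : ℝ≥0∞) ^ (-1 : ℝ) * (ENNReal.ofReal r ^ (2 - k) * (n : ℝ≥0∞) ^ (1 / k * (2 - k))
          * ENNReal.ofReal r ^ k)
        = ((n : ℝ≥0∞) ^ (-1 : ℝ) * (n : ℝ≥0∞) ^ (1 / k * (2 - k)))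
          * (ENNReal.ofReal r ^ (2 - k) * ENNReal.ofReal r ^ k) := by ring
      _ = _ := by
          rw [← ENNReal.rpow_add _ _ hn0 (by simp), ← ENNReal.rpow_add _ _ hR0 (by simp),
            ← ENNReal.rpow_two]
          congr 2
          · field_simp; ring
          · ring

/-- At this level `r^k / ρ^(k-1) = r * n^(-(1 - 1/k))`: squared bias and variance bound balance. -/
lemma truncationBias_sq_le_freeRate (hn : 1 ≤ n) (hk : 1 ≤ k) (hk2 : k < 2) (hr : 0 < r)
    (hP : P ∈ momentClass d k r) :
    truncationBias P (ENNReal.ofReal r * (n : ℝ≥0∞) ^ (1 / k)) ^ 2 ≤ freeRate k r n := by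
  have hR0 : ENNReal.ofReal r ≠ 0 := by simpa using hr
  have hn0 : (n : ℝ≥0∞) ≠ 0 := by simp; omega
  have hk0 : 0 < k := by linarith
  have h := truncationBias_mul_le (ρ := ENNReal.ofReal r * (n : ℝ≥0∞) ^ (1 / k)) hk hP
  set B := truncationBias P (ENNReal.ofReal r * (n : ℝ≥0∞) ^ (1 / k))
  rw [ENNReal.mul_rpow_of_nonneg _ _ (by linarith), ← ENNReal.rpow_mul] at h
  have h1 : B * (n : ℝ≥0∞) ^ (1 - 1 / k) ≤ ENNReal.ofReal r := by
    have h2 : ENNReal.ofReal r ^ (k - 1) * (B * (n : ℝ≥0∞) ^ (1 - 1 / k))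
        ≤ ENNReal.ofReal r ^ (k - 1) * ENNReal.ofReal r := by
      calc _ = B * (ENNReal.ofReal r ^ (k - 1) * (n : ℝ≥0∞) ^ (1 / k * (k - 1))) := by
            rw [show 1 / k * (k - 1) = 1 - 1 / k by field_simp]; ring
        _ ≤ ENNReal.ofReal r ^ k := h
        _ = ENNReal.ofReal r ^ (k - 1) * ENNReal.ofReal r ^ (1 : ℝ) := by
            rw [← ENNReal.rpow_add _ _ hR0 (by simp)]; congr 1; ring
        _ = _ := by rw [ENNReal.rpow_one]
    refine (ENNReal.mul_le_mul_iff_right ?_ ?_).1 h2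
    · exact (ENNReal.rpow_pos (pos_iff_ne_zero.2 hR0) (by simp)).ne'
    · exact ENNReal.rpow_ne_top_of_nonneg (by linarith) (by simp)
  rw [freeRate, min_one_two_mul_eq_of_le_two hk hk2.le, mul_comm, ENNReal.rpow_mul,
    ENNReal.rpow_two, ENNReal.le_div_iff_mul_le (Or.inr (by simpa using hr)) (Or.inr (by simp)),
    ← mul_pow]
  exact pow_le_pow_left' h1 2

/-- Halving the level costs `2^(k-1)` in the bias, hence `4^(k-1)` after squaring; the branch `r^2`
holds because the bias never exceeds `E ‖X‖ ≤ r`. -/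
lemma truncationBias_sq_le_stabilityRate (hk : 1 ≤ k) (hr : 0 < r) (a : ℝ≥0∞)
    (hP : P ∈ momentClass d k r) :
    truncationBias P (a / 2) ^ 2 ≤ ENNReal.ofReal ((4 : ℝ) ^ (k - 1)) *
      min (ENNReal.ofReal r ^ (2 * k) / a ^ (2 * (k - 1))) (ENNReal.ofReal r ^ 2) := by
  have hR0 : ENNReal.ofReal r ≠ 0 := by simpa using hr
  have h4 : ENNReal.ofReal ((4 : ℝ) ^ (k - 1)) = (2 : ℝ≥0∞) ^ (2 * (k - 1)) := by
    rw [← ENNReal.ofReal_rpow_of_pos (by norm_num), ENNReal.rpow_mul]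
    norm_num
  have h4' : 1 ≤ (2 : ℝ≥0∞) ^ (2 * (k - 1)) := by
    have := ENNReal.rpow_le_rpow_of_exponent_le (x := 2) (by norm_num)
      (show (0 : ℝ) ≤ 2 * (k - 1) by linarith)
    rwa [ENNReal.rpow_zero] at this
  rw [h4, mul_min]
  refine le_min ?_ ?_
  · rw [← mul_div_assoc, ENNReal.le_div_iff_mul_le (Or.inr ?_) (Or.inr ?_)]
    · have h := pow_le_pow_left' (truncationBias_mul_le (ρ := a / 2) hk hP) 2
      have hpow (x : ℝ≥0∞) (s : ℝ) : (x ^ s) ^ 2 = x ^ (2 * s) := by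
        rw [← ENNReal.rpow_two, ← ENNReal.rpow_mul, mul_comm]
      rw [mul_pow, hpow, hpow] at h
      have ha : a ^ (2 * (k - 1)) = (2 : ℝ≥0∞) ^ (2 * (k - 1)) * (a / 2) ^ (2 * (k - 1)) := by
        rw [← ENNReal.mul_rpow_of_nonneg _ _ (by linarith),
          ENNReal.mul_div_cancel (by norm_num) (by norm_num)]
      rw [ha, mul_left_comm]
      gcongr
    · refine mul_ne_zero (pos_of_gt (zero_lt_one.trans_le h4')).ne' ?_
      exact (ENNReal.rpow_pos (pos_iff_ne_zero.2 hR0) (by simp)).ne'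
    · exact ENNReal.mul_ne_top (ENNReal.rpow_ne_top_of_nonneg (by linarith) (by simp))
        (ENNReal.rpow_ne_top_of_nonneg (by linarith) (by simp))
  · calc truncationBias P (a / 2) ^ 2 ≤ 1 * ENNReal.ofReal r ^ 2 := by
          rw [one_mul]; exact pow_le_pow_left' (truncationBias_le hk hP) 2
      _ ≤ _ := by gcongr

end Truncation

/-! ### Stability and risk of the truncated mean. -/

section TruncatedMean

variable {d n : ℕ} {k r β : ℝ} {ρ : ℝ≥0∞}

lemma measurable_truncatedMean_data :
    Measurable fun D : Fin n → EuclideanSpace ℝ (Fin d) => (n : ℝ)⁻¹ • ∑ i, truncate ρ (D i) := by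
  have h (i : Fin n) : Measurable fun D : Fin n → EuclideanSpace ℝ (Fin d) => truncate ρ (D i) :=
    measurable_truncate.comp (measurable_pi_apply i)
  fun_prop

lemma isMeasurableEstimator_truncatedMean :
    IsMeasurableEstimator (truncatedMean (n := n) (d := d) ρ) :=
  measurable_truncatedMean_data.comp measurable_fst

/-- Two vectors of norm at most `nβ/2` are at distance at most `nβ`; this dictates the truncation
level. -/
lemma enorm_inv_smul_truncate_sub_le (hn : 1 ≤ n) (hρ : ρ ≤ n * ENNReal.ofReal β / 2)
    (x y : EuclideanSpace ℝ (Fin d)) :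
    ‖(n : ℝ)⁻¹ • (truncate ρ x - truncate ρ y)‖ₑ ≤ ENNReal.ofReal β := by
  have hn0 : (n : ℝ≥0∞) ≠ 0 := by simp; omega
  have hn' : (0 : ℝ) < n := by exact_mod_cast hn
  rw [enorm_smul, Real.enorm_of_nonneg (by positivity), ENNReal.ofReal_inv_of_pos hn',
    ENNReal.ofReal_natCast]
  calc (n : ℝ≥0∞)⁻¹ * ‖truncate ρ x - truncate ρ y‖ₑ
      ≤ (n : ℝ≥0∞)⁻¹ * (n * ENNReal.ofReal β / 2 + n * ENNReal.ofReal β / 2) := by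
        gcongr
        exact enorm_sub_le.trans (add_le_add ((enorm_truncate_le_level x).trans hρ)
          ((enorm_truncate_le_level y).trans hρ))
    _ = ENNReal.ofReal β := by
        rw [ENNReal.add_halves, ← mul_assoc, ENNReal.inv_mul_cancel hn0 (by simp), one_mul]

lemma isWorstCaseStable_truncatedMean (hn : 1 ≤ n) (hρ : ρ ≤ n * ENNReal.ofReal β / 2) :
    IsWorstCaseStable β (truncatedMean (n := n) (d := d) ρ) := by
  refine iSup_le fun D => iSup_le fun i => iSup_le fun x => ?_
  have h : (n : ℝ)⁻¹ • ∑ j, truncate ρ (D j)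
      - (n : ℝ)⁻¹ • ∑ j, truncate ρ (Function.update D i x j)
      = (n : ℝ)⁻¹ • (truncate ρ (D i) - truncate ρ x) := by
    rw [← smul_sub, ← Finset.sum_sub_distrib, Finset.sum_eq_single i]
    · simp
    · intro j _ hj; simp [hj]
    · simp
  simp only [truncatedMean, h, lintegral_const, measure_univ, mul_one]
  exact enorm_inv_smul_truncate_sub_le hn hρ _ _

lemma sum_removeNth {V : Type*} [AddCommGroup V] (Y : Fin (n + 1) → V) (i : Fin (n + 1)) :
    ∑ j, i.removeNth Y j = ∑ j, Y j - Y i := by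
  rw [Fin.sum_univ_succAbove Y i, add_sub_cancel_left]; rfl

lemma isLpStable_top_truncatedMean (hn : 1 ≤ n) (hρ : ρ ≤ n * ENNReal.ofReal β / 2) :
    IsLpStable ∞ β (truncatedMean (n := n) (d := d) ρ) := by
  rw [IsLpStable, if_pos rfl]
  refine iSup_le fun D => iSup_le fun i => iSup_le fun j => ?_
  have h : (n : ℝ)⁻¹ • ∑ l, truncate ρ (i.removeNth D l)
      - (n : ℝ)⁻¹ • ∑ l, truncate ρ (j.removeNth D l)
      = (n : ℝ)⁻¹ • (truncate ρ (D j) - truncate ρ (D i)) := by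
    have h1 (m : Fin (n + 1)) : ∑ l, truncate ρ (m.removeNth D l)
        = ∑ l, truncate ρ (D l) - truncate ρ (D m) := sum_removeNth (fun l => truncate ρ (D l)) m
    rw [h1, h1, ← smul_sub, sub_sub_sub_cancel_left]
  simp only [truncatedMean, h, lintegral_const, measure_univ, mul_one]
  exact enorm_inv_smul_truncate_sub_le hn hρ _ _

lemma risk_seedless {X E : Type*} [MeasurableSpace X] [NormedAddCommGroup E] [MeasurableSpace E]
    [OpensMeasurableSpace E] (P : ProbabilityMeasure X) (t : E) {g : (Fin n → X) → E}
    (hg : Measurable g) :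
    risk P t (fun D _ => g D)
      = ∫⁻ D, ‖g D - t‖ₑ ^ 2 ∂(Measure.pi fun _ : Fin n => (P : Measure X)) := by
  have hest : IsMeasurableEstimator (fun (D : Fin n → X) (_ : unitInterval) => g D) :=
    hg.comp measurable_fst
  rw [risk, lintegral_prod _ ((hest.measurable_enorm_sub t).pow_const 2).aemeasurable]
  simp

variable {P : ProbabilityMeasure (EuclideanSpace ℝ (Fin d))}

/-- Bias-variance bound for the truncated mean. -/
lemma lintegral_truncatedMean_sub_sq_le (hn : 1 ≤ n) (hk : 1 ≤ k) (hP : P ∈ momentClass d k r) :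
    ∫⁻ D, ‖(n : ℝ)⁻¹ • ∑ i, truncate ρ (D i) - meanOf P‖ₑ ^ 2
        ∂(Measure.pi fun _ : Fin n => (P : Measure (EuclideanSpace ℝ (Fin d))))
      ≤ 2 * ((n : ℝ≥0∞)⁻¹ * truncatedSecondMoment P ρ + truncationBias P ρ ^ 2) := by
  set μ := ∫ x, truncate ρ x ∂(P : Measure (EuclideanSpace ℝ (Fin d)))
  calc _ ≤ ∫⁻ D, 2 * (‖(n : ℝ)⁻¹ • ∑ i, truncate ρ (D i) - μ‖ₑ ^ 2 + ‖μ - meanOf P‖ₑ ^ 2)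
        ∂(Measure.pi fun _ : Fin n => (P : Measure (EuclideanSpace ℝ (Fin d)))) := by
        refine lintegral_mono fun D => ?_
        have := enorm_sub_sq_le ((n : ℝ)⁻¹ • ∑ i, truncate ρ (D i)) (meanOf P) μ
        rwa [← enorm_neg (μ - _), neg_sub] at this
    _ = 2 * ((∫⁻ D, ‖(n : ℝ)⁻¹ • ∑ i, truncate ρ (D i) - μ‖ₑ ^ 2
        ∂(Measure.pi fun _ : Fin n => (P : Measure (EuclideanSpace ℝ (Fin d)))))
          + ‖μ - meanOf P‖ₑ ^ 2) := by
        rw [lintegral_const_mul' _ _ ENNReal.ofNat_ne_top, lintegral_add_right _ measurable_const]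
        simp
    _ ≤ _ := by
        gcongr
        · exact lintegral_empiricalMean_sub_sq_le hn _ measurable_truncate
        · exact enorm_integral_truncate_sub_meanOf_le hk hP

lemma worstCaseLevel_le : worstCaseLevel k r n β ≤ n * ENNReal.ofReal β / 2 := by
  rw [worstCaseLevel]; split_ifs
  · exact min_le_left _ _
  · exact le_rfl

lemma truncationBias_worstCaseLevel_sq_le (hn : 1 ≤ n) (hk : 1 ≤ k) (hr : 0 < r)
    (hP : P ∈ momentClass d k r) :
    truncationBias P (worstCaseLevel k r n β) ^ 2
      ≤ ENNReal.ofReal ((4 : ℝ) ^ (k - 1)) *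
        min (ENNReal.ofReal r ^ (2 * k) / ((n : ℝ≥0∞) * ENNReal.ofReal β) ^ (2 * (k - 1)))
          (ENNReal.ofReal r ^ 2) + freeRate k r n := by
  have h := truncationBias_sq_le_stabilityRate hk hr (n * ENNReal.ofReal β) hP
  rw [worstCaseLevel]
  split_ifs with hk2
  · rcases min_choice (n * ENNReal.ofReal β / 2) (ENNReal.ofReal r * (n : ℝ≥0∞) ^ (1 / k))
      with hm | hm
    · rw [hm]; exact h.trans le_self_add
    · rw [hm]; exact (truncationBias_sq_le_freeRate hn hk hk2 hr hP).trans le_add_self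
  · exact h.trans le_self_add

theorem maxRisk_worstCaseEstimator_le (hn : 1 ≤ n) (hk : 1 ≤ k) (hr : 0 < r) :
    maxRisk (momentClass d k r) meanOf (worstCaseEstimator n d k r β)
      ≤ ENNReal.ofReal (4 * 4 ^ (k - 1)) * worstCaseRate k r n β := by
  refine iSup₂_le fun P hP => ?_
  have h4 : 1 ≤ ENNReal.ofReal ((4 : ℝ) ^ (k - 1)) :=
    ENNReal.one_le_ofReal.2 (Real.one_le_rpow (by norm_num) (by linarith))
  have hrisk : risk P (meanOf P) (worstCaseEstimator n d k r β) ≤ _ :=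
    (risk_seedless P (meanOf P) measurable_truncatedMean_data).trans_le
      (lintegral_truncatedMean_sub_sq_le (ρ := worstCaseLevel k r n β) hn hk hP)
  refine hrisk.trans ?_
  have h2 := truncatedSecondMoment_le_freeRate (ρ := worstCaseLevel k r n β) hn hk hr hP
    fun hk2 => by rw [worstCaseLevel, if_pos hk2]; exact min_le_right _ _
  have hb := truncationBias_worstCaseLevel_sq_le (β := β) hn hk hr hP
  rw [worstCaseRate, ENNReal.ofReal_mul (by norm_num)]
  set m := min (ENNReal.ofReal r ^ (2 * k) / ((n : ℝ≥0∞) * ENNReal.ofReal β) ^ (2 * (k - 1)))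
    (ENNReal.ofReal r ^ 2)
  set F := freeRate k r n
  set c := ENNReal.ofReal ((4 : ℝ) ^ (k - 1))
  have h5 : ENNReal.ofReal 4 = 2 * 2 := by norm_num
  rw [h5]
  calc _ ≤ 2 * (F + (c * m + F)) := by gcongr
    _ ≤ 2 * (c * F + (2 * (c * m) + c * F)) := by
        have hF : F ≤ c * F := by simpa using mul_le_mul_left h4 F
        have hm : c * m ≤ 2 * (c * m) := by rw [two_mul]; exact le_self_add
        gcongr
    _ = _ := by ring

end TruncatedMean

/-! ### Risk of the self-normalized mean. -/

section SelfNormalizedMean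

variable {d n : ℕ} {k r β : ℝ} {ρ : ℝ≥0∞}

lemma measurable_selfNormalizedMean_data :
    Measurable fun D : Fin n → EuclideanSpace ℝ (Fin d) =>
      min 1 (2 * n * r / ∑ i, ‖truncate ρ (D i)‖) • ((n : ℝ)⁻¹ • ∑ i, truncate ρ (D i)) := by
  have h (i : Fin n) : Measurable fun D : Fin n → EuclideanSpace ℝ (Fin d) => truncate ρ (D i) :=
    measurable_truncate.comp (measurable_pi_apply i)
  fun_prop

lemma isMeasurableEstimator_averageCaseEstimator :
    IsMeasurableEstimator (averageCaseEstimator n d k r β) :=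
  (measurable_selfNormalizedMean_data.const_smul (min (β * n / (24 * r)) 1)).comp measurable_fst

lemma norm_inv_smul_sum_le {V : Type*} [NormedAddCommGroup V] [NormedSpace ℝ V] (Y : Fin n → V) :
    ‖(n : ℝ)⁻¹ • ∑ i, Y i‖ ≤ (n : ℝ)⁻¹ * ∑ i, ‖Y i‖ := by
  rw [norm_smul, Real.norm_of_nonneg (by positivity)]
  gcongr
  exact norm_sum_le _ _

lemma min_one_div_mem (hr : 0 ≤ r) {T : ℝ} (hT : 0 ≤ T) :
    0 ≤ min 1 (2 * n * r / T) ∧ min 1 (2 * n * r / T) ≤ 1 :=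
  ⟨le_min zero_le_one (by positivity), min_le_left _ _⟩

/-- Self-normalization moves the mean by at most the error made in estimating the mean norm. -/
lemma norm_selfNormalized_sub_le {V : Type*} [NormedAddCommGroup V] [NormedSpace ℝ V]
    (hn : 1 ≤ n) (hr : 0 < r) (Y : Fin n → V) (t : V) {τ : ℝ} (hτ : τ ≤ r) :
    ‖min 1 (2 * n * r / ∑ i, ‖Y i‖) • ((n : ℝ)⁻¹ • ∑ i, Y i) - t‖
      ≤ ‖(n : ℝ)⁻¹ • ∑ i, Y i - t‖ + ‖(n : ℝ)⁻¹ • ∑ i, ‖Y i‖ - τ‖ := by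
  have hn' : (0 : ℝ) < n := by exact_mod_cast hn
  set T := ∑ i, ‖Y i‖ with hT
  have hT0 : 0 ≤ T := Finset.sum_nonneg fun i _ => norm_nonneg _
  set h := (n : ℝ)⁻¹ • ∑ i, Y i
  have hh : ‖h‖ ≤ (n : ℝ)⁻¹ * T := norm_inv_smul_sum_le Y
  set m := min 1 (2 * n * r / T) with hm
  obtain ⟨hm0, hm1⟩ : 0 ≤ m ∧ m ≤ 1 := min_one_div_mem hr.le hT0
  -- Shrinkage occurs only if `T/n > 2r`, and then it removes `T/n - 2r ≤ T/n - τ`. For `T = 0` the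
  -- quotient is `0` by convention, but the left side vanishes.
  have key : (1 - m) * ((n : ℝ)⁻¹ * T) ≤ ‖(n : ℝ)⁻¹ • T - τ‖ := by
    rcases hT0.eq_or_lt with h0 | h0
    · rw [← h0]; simp
    rcases le_or_gt T (2 * n * r) with h1 | h1
    · have : m = 1 := min_eq_left ((one_le_div h0).2 h1)
      rw [this]; simp
    · have : m = 2 * n * r / T := min_eq_right ((div_le_one h0).2 h1.le)
      refine le_trans ?_ (le_abs_self _)
      rw [this, smul_eq_mul]
      have : (1 - 2 * n * r / T) * ((n : ℝ)⁻¹ * T) = (n : ℝ)⁻¹ * T - 2 * r := by field_simp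
      linarith
  calc ‖m • h - t‖ = ‖(h - t) - (1 - m) • h‖ := by congr 1; module
    _ ≤ ‖h - t‖ + ‖(1 - m) • h‖ := norm_sub_le _ _
    _ = ‖h - t‖ + (1 - m) * ‖h‖ := by rw [norm_smul, Real.norm_of_nonneg (by linarith)]
    _ ≤ ‖h - t‖ + (1 - m) * ((n : ℝ)⁻¹ * T) := by
        gcongr
    _ ≤ _ := by gcongr

lemma norm_selfNormalized_le {V : Type*} [NormedAddCommGroup V] [NormedSpace ℝ V]
    (hn : 1 ≤ n) (hr : 0 < r) (Y : Fin n → V) :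
    ‖min 1 (2 * n * r / ∑ i, ‖Y i‖) • ((n : ℝ)⁻¹ • ∑ i, Y i)‖ ≤ 2 * r := by
  have hn' : (0 : ℝ) < n := by exact_mod_cast hn
  have hh := norm_inv_smul_sum_le Y
  set T := ∑ i, ‖Y i‖ with hT
  have hT0 : 0 ≤ T := Finset.sum_nonneg fun i _ => norm_nonneg _
  obtain ⟨hm0, hm1⟩ := min_one_div_mem (n := n) hr.le hT0
  rw [norm_smul, Real.norm_of_nonneg hm0]
  refine (mul_le_mul_of_nonneg_left hh hm0).trans ?_
  rcases hT0.eq_or_lt with h0 | h0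
  · rw [← h0]; simp [hr.le]
  · calc _ ≤ 2 * n * r / T * ((n : ℝ)⁻¹ * T) := by gcongr; exact min_le_right _ _
      _ = 2 * r := by field_simp

variable {P : ProbabilityMeasure (EuclideanSpace ℝ (Fin d))}

lemma lintegral_selfNormalizedMean_sub_sq_le (hn : 1 ≤ n) (hk : 1 ≤ k) (hr : 0 < r)
    (hP : P ∈ momentClass d k r) :
    ∫⁻ D, ‖min 1 (2 * n * r / ∑ i, ‖truncate ρ (D i)‖) • ((n : ℝ)⁻¹ • ∑ i, truncate ρ (D i))
        - meanOf P‖ₑ ^ 2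
        ∂(Measure.pi fun _ : Fin n => (P : Measure (EuclideanSpace ℝ (Fin d))))
      ≤ 6 * ((n : ℝ≥0∞)⁻¹ * truncatedSecondMoment P ρ) + 4 * truncationBias P ρ ^ 2 := by
  set τ := ∫ x, ‖truncate ρ x‖ ∂(P : Measure (EuclideanSpace ℝ (Fin d)))
  have hτ : τ ≤ r := by
    have h1 : ENNReal.ofReal τ ≤ ENNReal.ofReal r := by
      rw [ofReal_integral_norm_eq_lintegral_enorm (integrable_truncate_of_mem hk hP)]
      exact (lintegral_mono enorm_truncate_le).trans (lintegral_enorm_le_of_mem hk hP)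
    exact (ENNReal.ofReal_le_ofReal_iff hr.le).1 h1
  have hpt (D : Fin n → EuclideanSpace ℝ (Fin d)) :
      ‖min 1 (2 * n * r / ∑ i, ‖truncate ρ (D i)‖) • ((n : ℝ)⁻¹ • ∑ i, truncate ρ (D i))
        - meanOf P‖ₑ ^ 2
      ≤ 2 * (‖(n : ℝ)⁻¹ • ∑ i, truncate ρ (D i) - meanOf P‖ₑ ^ 2
        + ‖(n : ℝ)⁻¹ • ∑ i, ‖truncate ρ (D i)‖ - τ‖ₑ ^ 2) := by
    have h1 := norm_selfNormalized_sub_le hn hr (fun i => truncate ρ (D i)) (meanOf P) hτ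
    have h2 := (pow_le_pow_left₀ (norm_nonneg _) h1 2).trans (add_sq_le (a := ‖_‖) (b := ‖_‖))
    have h3 := ENNReal.ofReal_le_ofReal h2
    rw [ENNReal.ofReal_mul zero_le_two, ENNReal.ofReal_add (by positivity) (by positivity)] at h3
    simpa only [ENNReal.ofReal_pow (norm_nonneg _), ofReal_norm, ENNReal.ofReal_ofNat] using h3
  refine (lintegral_mono hpt).trans ?_
  have hm : Measurable fun D : Fin n → EuclideanSpace ℝ (Fin d) =>
      ‖(n : ℝ)⁻¹ • ∑ i, truncate ρ (D i) - meanOf P‖ₑ ^ 2 :=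
    (measurable_truncatedMean_data.sub_const _).enorm.pow_const 2
  rw [lintegral_const_mul' _ _ ENNReal.ofNat_ne_top, lintegral_add_left hm]
  have h4 := lintegral_truncatedMean_sub_sq_le (ρ := ρ) hn hk hP
  have h5 := lintegral_empiricalMean_sub_sq_le_real hn
    (P : Measure (EuclideanSpace ℝ (Fin d))) (measurable_truncate (ρ := ρ)).norm
  simp only [enorm_norm] at h5
  -- Vectors and norms have the same second moment, so `2 * (2 * (V + B^2) + V) = 6V + 4B^2`.
  refine (mul_le_mul_right (add_le_add h4 h5) 2).trans (le_of_eq ?_)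
  rw [truncatedSecondMoment]
  ring

lemma maxRisk_averageCaseEstimator_le_freeRate (hn : 1 ≤ n) (hk : 1 ≤ k) (hr : 0 < r)
    (hβ : 24 * r / n ≤ β) :
    maxRisk (momentClass d k r) meanOf (averageCaseEstimator n d k r β)
      ≤ ENNReal.ofReal 10 * freeRate k r n := by
  have hn' : (0 : ℝ) < n := by exact_mod_cast hn
  refine iSup₂_le fun P hP => ?_
  have ha : min (β * n / (24 * r)) 1 = 1 := by
    rw [div_le_iff₀ hn'] at hβ
    exact min_eq_right ((one_le_div (by positivity)).2 hβ)
  have h1 : averageCaseEstimator n d k r β = selfNormalizedMean r (averageCaseLevel k r n) := by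
    ext1 D; ext1 ξ; rw [averageCaseEstimator, ha, one_smul]
  have hrisk : risk P (meanOf P) (selfNormalizedMean r (averageCaseLevel k r n)) ≤ _ :=
    (risk_seedless P (meanOf P) measurable_selfNormalizedMean_data).trans_le
      (lintegral_selfNormalizedMean_sub_sq_le (ρ := averageCaseLevel k r n) hn hk hr hP)
  rw [h1]
  refine hrisk.trans ?_
  have h2 := truncatedSecondMoment_le_freeRate (ρ := averageCaseLevel k r n) hn hk hr hP
    fun hk2 => by rw [averageCaseLevel, if_pos hk2]
  have hb : truncationBias P (averageCaseLevel k r n) ^ 2 ≤ freeRate k r n := by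
    rw [averageCaseLevel]
    split_ifs with hk2
    · exact truncationBias_sq_le_freeRate hn hk hk2 hr hP
    · rw [truncationBias_top]; simp
  calc _ ≤ 6 * freeRate k r n + 4 * freeRate k r n := by gcongr
    _ = _ := by rw [← add_mul]; norm_num

lemma maxRisk_averageCaseEstimator_le_sq (hn : 1 ≤ n) (hk : 1 ≤ k) (hr : 0 < r) (hβ : 0 ≤ β) :
    maxRisk (momentClass d k r) meanOf (averageCaseEstimator n d k r β)
      ≤ ENNReal.ofReal 10 * ENNReal.ofReal r ^ 2 := by
  refine iSup₂_le fun P hP => ?_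
  have hest (D : Fin n → EuclideanSpace ℝ (Fin d)) (ξ : unitInterval) :
      ‖averageCaseEstimator n d k r β D ξ - meanOf P‖ₑ ≤ ENNReal.ofReal (3 * r) := by
    have ha0 : 0 ≤ min (β * n / (24 * r)) 1 := le_min (by positivity) zero_le_one
    have h1 : ‖averageCaseEstimator n d k r β D ξ‖ ≤ 2 * r := by
      have h2 : ‖selfNormalizedMean r (averageCaseLevel k r n) D ξ‖ ≤ 2 * r :=
        norm_selfNormalized_le hn hr _
      rw [averageCaseEstimator, norm_smul, Real.norm_of_nonneg ha0]
      exact (mul_le_of_le_one_left (norm_nonneg _) (min_le_right _ _)).trans h2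
    calc _ ≤ ‖averageCaseEstimator n d k r β D ξ‖ₑ + ‖meanOf P‖ₑ := enorm_sub_le
      _ ≤ ENNReal.ofReal (2 * r) + ENNReal.ofReal r := by
          gcongr
          · rw [← ofReal_norm]; exact ENNReal.ofReal_le_ofReal h1
          · exact enorm_meanOf_le hk hP
      _ = _ := by rw [← ENNReal.ofReal_add (by positivity) hr.le]; congr 1; ring
  calc risk P (meanOf P) (averageCaseEstimator n d k r β)
      ≤ ∫⁻ _, ENNReal.ofReal (3 * r) ^ 2
        ∂((Measure.pi fun _ : Fin n => (P : Measure (EuclideanSpace ℝ (Fin d)))).prod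
          (volume : Measure unitInterval)) :=
        lintegral_mono fun z => pow_le_pow_left' (hest z.1 z.2) 2
    _ = ENNReal.ofReal (3 * r) ^ 2 := by simp
    _ ≤ _ := by
        rw [← ENNReal.ofReal_pow (by positivity), ← ENNReal.ofReal_pow hr.le,
          ← ENNReal.ofReal_mul (by norm_num)]
        exact ENNReal.ofReal_le_ofReal (by nlinarith [sq_nonneg r])

end SelfNormalizedMean

/-! ### Average-case stability of the self-normalized mean. -/

section AverageCaseStability

variable {V : Type*} [NormedAddCommGroup V] [NormedSpace ℝ V] {n : ℕ}

/-- The Lipschitz factor involves only one of the two normalizations, so the more favourable one can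
be chosen. The change of normalization is absorbed by `‖v‖ ≤ max t c`. -/
lemma norm_div_max_smul_sub_le {c : ℝ} (hc : 0 < c) {u v : V} {s t : ℝ} (hv : ‖v‖ ≤ t) :
    ‖(c / max s c) • u - (c / max t c) • v‖ ≤ c / max s c * (‖u - v‖ + |s - t|) := by
  have hs0 : 0 < max s c := lt_max_of_lt_right hc
  have ht0 : 0 < max t c := lt_max_of_lt_right hc
  have hm : 0 ≤ c / max s c := by positivity
  have h1 : |c / max s c - c / max t c| * ‖v‖ ≤ c / max s c * |s - t| := by
    have h2 : c / max s c - c / max t c = c / max s c * ((max t c - max s c) / max t c) := by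
      field_simp
    rw [h2, abs_mul, abs_of_nonneg hm, abs_div, abs_of_pos ht0, mul_assoc]
    refine mul_le_mul_of_nonneg_left ?_ hm
    rw [div_mul_eq_mul_div, div_le_iff₀ ht0]
    refine mul_le_mul ?_ (hv.trans (le_max_left _ _)) (norm_nonneg _) (abs_nonneg _)
    rw [abs_sub_comm s t]
    exact abs_max_sub_max_le_abs _ _ _
  calc ‖(c / max s c) • u - (c / max t c) • v‖
      = ‖(c / max s c) • (u - v) + (c / max s c - c / max t c) • v‖ := by congr 1; module
    _ ≤ c / max s c * ‖u - v‖ + |c / max s c - c / max t c| * ‖v‖ := by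
        refine (norm_add_le _ _).trans (le_of_eq ?_)
        rw [norm_smul, norm_smul, Real.norm_of_nonneg hm, Real.norm_eq_abs]
    _ ≤ _ := by rw [mul_add]; gcongr

/-- The two factors differ at `t = 0`, where `c / 0 = 0`, but there `u = 0`. -/
lemma min_one_div_smul_eq {c : ℝ} (hc : 0 < c) {u : V} {t : ℝ} (hu : ‖u‖ ≤ t) :
    min 1 (c / t) • u = (c / max t c) • u := by
  have ht : 0 ≤ t := (norm_nonneg u).trans hu
  rcases ht.eq_or_lt with h0 | h0
  · have : u = 0 := norm_le_zero_iff.1 (by rwa [← h0] at hu)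
    simp [this]
  · congr 1
    rcases le_total t c with h | h
    · rw [max_eq_right h, div_self hc.ne', min_eq_left ((one_le_div h0).2 h)]
    · rw [max_eq_left h, min_eq_right ((div_le_one h0).2 h)]

/-- Deleting a point from a self-normalized sum changes it little on average. -/
lemma sum_norm_selfNormalized_removeNth_sub_le {c : ℝ} (hc : 0 < c) (Y : Fin (n + 1) → V) :
    ∑ i : Fin (n + 1), ∑ j : Fin (n + 1),
      ‖min 1 (c / ∑ l, ‖i.removeNth Y l‖) • ∑ l, i.removeNth Y l
        - min 1 (c / ∑ l, ‖j.removeNth Y l‖) • ∑ l, j.removeNth Y l‖ ≤ 8 * c * (n + 1) := by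
  set T := ∑ l, ‖Y l‖ with hT
  have hT0 : 0 ≤ T := Finset.sum_nonneg fun _ _ => norm_nonneg _
  have hsum (i : Fin (n + 1)) : ∑ l, ‖i.removeNth Y l‖ = T - ‖Y i‖ :=
    sum_removeNth (fun l => ‖Y l‖) i
  have hle (i : Fin (n + 1)) : ‖∑ l, i.removeNth Y l‖ ≤ T - ‖Y i‖ := by
    rw [← hsum]; exact norm_sum_le _ _
  have hnn (i : Fin (n + 1)) : 0 ≤ T - ‖Y i‖ := (norm_nonneg _).trans (hle i)
  set φ : Fin (n + 1) → V := fun i =>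
    min 1 (c / ∑ l, ‖i.removeNth Y l‖) • ∑ l, i.removeNth Y l with hφ
  have hφ' (i : Fin (n + 1)) :
      φ i = (c / max (T - ‖Y i‖) c) • ∑ l, i.removeNth Y l := by
    rw [hφ]; simp only [hsum]; exact min_one_div_smul_eq hc (hle i)
  have hstep (i j : Fin (n + 1)) :
      ‖φ i - φ j‖ ≤ c / max (T - ‖Y i‖) c * (2 * (‖Y i‖ + ‖Y j‖)) := by
    rw [hφ', hφ']
    refine (norm_div_max_smul_sub_le hc (hle j)).trans ?_
    have hm : 0 ≤ c / max (T - ‖Y i‖) c := by positivity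
    refine mul_le_mul_of_nonneg_left ?_ hm
    have h1 : ‖∑ l, i.removeNth Y l - ∑ l, j.removeNth Y l‖ ≤ ‖Y i‖ + ‖Y j‖ := by
      rw [sum_removeNth, sum_removeNth, sub_sub_sub_cancel_left, add_comm]
      exact norm_sub_le _ _
    have h2 : |T - ‖Y i‖ - (T - ‖Y j‖)| ≤ ‖Y i‖ + ‖Y j‖ := by
      rw [abs_le]; constructor <;> linarith [norm_nonneg (Y i), norm_nonneg (Y j)]
    linarith
  -- Of two different points, one leaves at least half of the total behind.
  have hhalf (i j : Fin (n + 1)) (hi : T ≤ 2 * (T - ‖Y i‖)) :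
      T * ‖φ i - φ j‖ ≤ 4 * c * (‖Y i‖ + ‖Y j‖) := by
    have h1 : T * (c / max (T - ‖Y i‖) c) ≤ 2 * c := by
      rw [mul_div_assoc', div_le_iff₀ (lt_max_of_lt_right hc)]
      nlinarith [le_max_left (T - ‖Y i‖) c]
    calc T * ‖φ i - φ j‖ ≤ T * (c / max (T - ‖Y i‖) c * (2 * (‖Y i‖ + ‖Y j‖))) := by
          gcongr; exact hstep i j
      _ = T * (c / max (T - ‖Y i‖) c) * (2 * (‖Y i‖ + ‖Y j‖)) := by ring
      _ ≤ 2 * c * (2 * (‖Y i‖ + ‖Y j‖)) := by gcongr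
      _ = _ := by ring
  have hpair (i j : Fin (n + 1)) : T * ‖φ i - φ j‖ ≤ 4 * c * (‖Y i‖ + ‖Y j‖) := by
    rcases eq_or_ne i j with rfl | hij
    · rw [sub_self, norm_zero, mul_zero]; positivity
    · have h1 : ‖Y i‖ + ‖Y j‖ ≤ T := by
        rw [hT, ← Finset.sum_pair hij (f := fun l => ‖Y l‖)]
        exact Finset.sum_le_sum_of_subset_of_nonneg (Finset.subset_univ _)
          fun _ _ _ => norm_nonneg _
      rcases le_total ‖Y i‖ ‖Y j‖ with h | h
      · exact hhalf i j (by linarith)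
      · rw [norm_sub_rev, add_comm]
        exact hhalf j i (by linarith)
  -- The sum of `‖Y i‖ + ‖Y j‖` over all pairs is `2 * (n + 1) * T`, so `T` cancels and the bound
  -- does not depend on the data.
  have htotal : T * ∑ i, ∑ j, ‖φ i - φ j‖ ≤ T * (8 * c * (n + 1)) := by
    simp_rw [Finset.mul_sum]
    calc ∑ i, ∑ j, T * ‖φ i - φ j‖ ≤ ∑ i : Fin (n + 1), ∑ j : Fin (n + 1),
          4 * c * (‖Y i‖ + ‖Y j‖) :=
          Finset.sum_le_sum fun i _ => Finset.sum_le_sum fun j _ => hpair i j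
      _ = _ := by
          simp_rw [← Finset.mul_sum, Finset.sum_add_distrib]
          simp only [Finset.sum_const, Finset.card_univ, Fintype.card_fin, nsmul_eq_mul,
            ← Finset.mul_sum, ← hT]
          push_cast
          ring
  rcases hT0.eq_or_lt with h0 | h0
  · have hY (i : Fin (n + 1)) : ‖Y i‖ = 0 := by
      have := (Finset.sum_eq_zero_iff_of_nonneg fun _ _ => norm_nonneg _).1 (hT.symm.trans h0.symm)
      exact this i (Finset.mem_univ i)
    calc ∑ i, ∑ j, ‖φ i - φ j‖ ≤ ∑ i : Fin (n + 1), ∑ j : Fin (n + 1), (0 : ℝ) :=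
          Finset.sum_le_sum fun i _ => Finset.sum_le_sum fun j _ =>
            (hstep i j).trans_eq (by rw [hY, hY]; ring)
      _ ≤ _ := by simp only [Finset.sum_const_zero]; positivity
  · exact le_of_mul_le_mul_left htotal h0

variable {d : ℕ} {k r β : ℝ}

lemma isLpStable_one_averageCaseEstimator (hn : 1 ≤ n) (hr : 0 < r) (hβ : 0 ≤ β) :
    IsLpStable 1 β (averageCaseEstimator n d k r β) := by
  have hn' : (0 : ℝ) < n := by exact_mod_cast hn
  rw [IsLpStable, if_neg ENNReal.one_ne_top]
  simp only [ENNReal.toReal_one, div_one, ENNReal.rpow_one]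
  have h0 : ((n : ℝ≥0∞) + 1) ^ 2 ≠ 0 := by simp
  have ht : ((n : ℝ≥0∞) + 1) ^ 2 ≠ ∞ := by finiteness
  rw [← ENNReal.div_eq_inv_mul, ENNReal.div_le_iff' h0 ht]
  refine iSup_le fun D => ?_
  have hc : ENNReal.ofReal (((n : ℝ) + 1) ^ 2) = ((n : ℝ≥0∞) + 1) ^ 2 := by
    rw [ENNReal.ofReal_pow (by positivity), ENNReal.ofReal_add (by positivity) zero_le_one]
    simp
  rw [← hc, ← ENNReal.ofReal_mul (by positivity)]
  set ρ := averageCaseLevel k r n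
  set Y : Fin (n + 1) → EuclideanSpace ℝ (Fin d) := fun l => truncate ρ (D l)
  set a := min (β * n / (24 * r)) 1
  have ha0 : 0 ≤ a := le_min (by positivity) zero_le_one
  have hest (i : Fin (n + 1)) (ξ : unitInterval) :
      averageCaseEstimator n d k r β (i.removeNth D) ξ
        = (a * (n : ℝ)⁻¹) • (min 1 (2 * n * r / ∑ l, ‖i.removeNth Y l‖) • ∑ l, i.removeNth Y l) := by
    change a • (min 1 (2 * n * r / ∑ l, ‖i.removeNth Y l‖)
      • ((n : ℝ)⁻¹ • ∑ l, i.removeNth Y l)) = _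
    rw [mul_smul, smul_comm (min 1 _)]
  have hterm (i j : Fin (n + 1)) :
      ∫⁻ ξ, ‖averageCaseEstimator n d k r β (i.removeNth D) ξ
          - averageCaseEstimator n d k r β (j.removeNth D) ξ‖ₑ
        = ENNReal.ofReal (a * (n : ℝ)⁻¹ *
          ‖min 1 (2 * n * r / ∑ l, ‖i.removeNth Y l‖) • ∑ l, i.removeNth Y l
            - min 1 (2 * n * r / ∑ l, ‖j.removeNth Y l‖) • ∑ l, j.removeNth Y l‖) := by
    simp only [hest, ← smul_sub, lintegral_const, measure_univ, mul_one]
    rw [← ofReal_norm, norm_smul, Real.norm_of_nonneg (by positivity)]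
  simp_rw [hterm]
  rw [Finset.sum_congr rfl fun i _ =>
      (ENNReal.ofReal_sum_of_nonneg fun j _ => by positivity).symm,
    ← ENNReal.ofReal_sum_of_nonneg fun i _ => Finset.sum_nonneg fun j _ => by positivity]
  refine ENNReal.ofReal_le_ofReal ?_
  simp_rw [← Finset.mul_sum]
  -- With `c = 2nr` the pair bound is `16 * n * r * (n + 1)`; the shrinkage by `24r` leaves a factor
  -- `2/3` to spare.
  calc a * (n : ℝ)⁻¹ * _ ≤ a * (n : ℝ)⁻¹ * (8 * (2 * n * r) * (n + 1)) := by
        gcongr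
        exact sum_norm_selfNormalized_removeNth_sub_le (by positivity) Y
    _ ≤ β * n / (24 * r) * (n : ℝ)⁻¹ * (8 * (2 * n * r) * (n + 1)) := by
        gcongr; exact min_le_left _ _
    _ = 2 / 3 * n * ((n + 1) * β) := by field_simp; ring
    _ ≤ (n + 1) * ((n + 1) * β) := by gcongr; linarith
    _ = _ := by ring

end AverageCaseStability

/-! ### Assembling the minimax bounds. -/

section Minimax

variable {d n : ℕ} {k r β : ℝ}

lemma constrainedMinimaxRisk_le_maxRisk {X E : Type*} [MeasurableSpace X] [NormedAddCommGroup E]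
    [MeasurableSpace E] {stable : Estimator n X E → Prop} {𝓠 : Set (ProbabilityMeasure X)}
    {θ : ProbabilityMeasure X → E} {est : Estimator n X E} (hest : IsMeasurableEstimator est)
    (hs : stable est) : constrainedMinimaxRisk n stable 𝓠 θ ≤ maxRisk 𝓠 θ est :=
  iInf_le_of_le est <| iInf_le_of_le hest <| iInf_le_of_le hs le_rfl

lemma worstCaseMinimaxRisk_le_lpMinimaxRisk_top {X E : Type*} [MeasurableSpace X]
    [NormedAddCommGroup E] [MeasurableSpace E] (𝓠 : Set (ProbabilityMeasure X))
    (θ : ProbabilityMeasure X → E) :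
    worstCaseMinimaxRisk n 𝓠 θ β ≤ lpMinimaxRisk n ∞ 𝓠 θ β :=
  le_iInf fun _ => le_iInf fun hest => le_iInf fun hs =>
    constrainedMinimaxRisk_le_maxRisk hest hs.isWorstCaseStable

/-- The constant in the lower bound under worst-case stability. -/
def worstCaseConstant (k : ℝ) : ℝ := 1 / 64 * (1 / 4) ^ (2 * (k - 1))

lemma worstCaseConstant_pos (k : ℝ) : 0 < worstCaseConstant k := by
  unfold worstCaseConstant; positivity

theorem worstCaseRate_le_worstCaseMinimaxRisk (hd : 1 ≤ d) (hn : 1 ≤ n) (hk : 1 ≤ k) (hr : 0 < r)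
    (hβ : 0 ≤ β) :
    ENNReal.ofReal (worstCaseConstant k) * worstCaseRate k r n β
      ≤ worstCaseMinimaxRisk n (momentClass d k r) meanOf β := by
  refine le_iInf fun est => le_iInf fun hest => le_iInf fun hs => ?_
  have h1 := hs.le_maxRisk hd hk hr hβ hest
  have h2 := freeRate_le_maxRisk hd hn hk hr hest
  set M := maxRisk (momentClass d k r) meanOf est
  have hpow : ((1 : ℝ) / 4) ^ (2 * (k - 1)) ≤ 1 :=
    Real.rpow_le_one (by norm_num) (by norm_num) (by linarith)
  have hpow0 : 0 ≤ ((1 : ℝ) / 4) ^ (2 * (k - 1)) := by positivity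
  -- The rate is a sum of two terms, each bounded separately; half of each constant lets the bounds
  -- be added, and `1/64` is half of `1/32`.
  have hle {u : ℝ} (hu : 2 * worstCaseConstant k ≤ u) {x : ℝ≥0∞} (hx : ENNReal.ofReal u * x ≤ M) :
      2 * (ENNReal.ofReal (worstCaseConstant k) * x) ≤ M := by
    refine le_trans ?_ hx
    rw [← mul_assoc, show (2 : ℝ≥0∞) = ENNReal.ofReal 2 by simp, ← ENNReal.ofReal_mul zero_le_two]
    gcongr
  have h1' := hle (by unfold worstCaseConstant; linarith) h1
  have h2' := hle (by unfold worstCaseConstant; linarith) h2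
  rw [worstCaseRate, ← ENNReal.mul_le_mul_iff_right (a := 2) (by simp) (by simp), mul_add, mul_add]
  exact (add_le_add h1' h2').trans_eq (two_mul M).symm

end Minimax

end StableEstimation

end

open StableEstimation in
theorem theorem7 :
    -- (a) worst-case stability
    (∀ k : ℝ, 1 ≤ k → ∃ c C : ℝ, 0 < c ∧ 0 < C ∧
      ∀ (d n : ℕ) (r β : ℝ), 1 ≤ d → 1 ≤ n → 0 < r → 0 ≤ β →
        ENNReal.ofReal c * worstCaseRate k r n β
            ≤ lpMinimaxRisk n ∞ (momentClass d k r) meanOf β ∧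
        lpMinimaxRisk n ∞ (momentClass d k r) meanOf β
            ≤ ENNReal.ofReal C * worstCaseRate k r n β ∧
        ENNReal.ofReal c * worstCaseRate k r n β
            ≤ worstCaseMinimaxRisk n (momentClass d k r) meanOf β ∧
        worstCaseMinimaxRisk n (momentClass d k r) meanOf β
            ≤ ENNReal.ofReal C * worstCaseRate k r n β ∧
        IsMeasurableEstimator (worstCaseEstimator n d k r β) ∧
        IsLpStable ∞ β (worstCaseEstimator n d k r β) ∧
        IsWorstCaseStable β (worstCaseEstimator n d k r β) ∧
        maxRisk (momentClass d k r) meanOf (worstCaseEstimator n d k r β)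
            ≤ ENNReal.ofReal C * worstCaseRate k r n β) ∧
    -- (b) average-case stability
    (∃ c C : ℝ, 0 < c ∧ 0 < C ∧
      ∀ (k : ℝ) (d n : ℕ) (r β : ℝ), 1 ≤ k → 1 ≤ d → 1 ≤ n → 0 < r → 0 ≤ β →
        IsMeasurableEstimator (averageCaseEstimator n d k r β) ∧
        IsLpStable 1 β (averageCaseEstimator n d k r β) ∧
        (24 * r / n ≤ β →
          ENNReal.ofReal c * freeRate k r n
              ≤ lpMinimaxRisk n 1 (momentClass d k r) meanOf β ∧
          lpMinimaxRisk n 1 (momentClass d k r) meanOf β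
              ≤ ENNReal.ofReal C * freeRate k r n ∧
          maxRisk (momentClass d k r) meanOf (averageCaseEstimator n d k r β)
              ≤ ENNReal.ofReal C * freeRate k r n) ∧
        (β ≤ r / (10 * n) →
          ENNReal.ofReal c * ENNReal.ofReal r ^ 2
              ≤ lpMinimaxRisk n 1 (momentClass d k r) meanOf β ∧
          lpMinimaxRisk n 1 (momentClass d k r) meanOf β
              ≤ ENNReal.ofReal C * ENNReal.ofReal r ^ 2 ∧
          maxRisk (momentClass d k r) meanOf (averageCaseEstimator n d k r β)
              ≤ ENNReal.ofReal C * ENNReal.ofReal r ^ 2)) := by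
  refine ⟨fun k hk => ⟨worstCaseConstant k, 4 * 4 ^ (k - 1), worstCaseConstant_pos k,
    by positivity, fun d n r β hd hn hr hβ => ?_⟩, 1 / 32, 10, by norm_num, by norm_num,
    fun k d n r β hk hd hn hr hβ => ?_⟩
  · have hm : IsMeasurableEstimator (worstCaseEstimator n d k r β) :=
      isMeasurableEstimator_truncatedMean
    have hl : IsLpStable ∞ β (worstCaseEstimator n d k r β) :=
      isLpStable_top_truncatedMean hn worstCaseLevel_le
    have hw : IsWorstCaseStable β (worstCaseEstimator n d k r β) :=
      isWorstCaseStable_truncatedMean hn worstCaseLevel_le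
    have hrisk := maxRisk_worstCaseEstimator_le (d := d) (β := β) hn hk hr
    have hlow := worstCaseRate_le_worstCaseMinimaxRisk hd hn hk hr hβ
    exact ⟨hlow.trans (worstCaseMinimaxRisk_le_lpMinimaxRisk_top _ _),
      (constrainedMinimaxRisk_le_maxRisk hm hl).trans hrisk, hlow,
      (constrainedMinimaxRisk_le_maxRisk hm hw).trans hrisk, hm, hl, hw, hrisk⟩
  · have hm : IsMeasurableEstimator (averageCaseEstimator n d k r β) :=
      isMeasurableEstimator_averageCaseEstimator
    have hs : IsLpStable 1 β (averageCaseEstimator n d k r β) :=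
      isLpStable_one_averageCaseEstimator hn hr hβ
    refine ⟨hm, hs, fun hlarge => ?_, fun hsmall => ?_⟩
    · have hrisk := maxRisk_averageCaseEstimator_le_freeRate (d := d) hn hk hr hlarge
      -- Above the critical level stability costs only a constant: the lower bound valid for all
      -- estimators is matched.
      exact ⟨le_iInf fun _ => le_iInf fun hest => le_iInf fun _ =>
        freeRate_le_maxRisk hd hn hk hr hest,
        (constrainedMinimaxRisk_le_maxRisk hm hs).trans hrisk, hrisk⟩
    · have hrisk := maxRisk_averageCaseEstimator_le_sq (d := d) hn hk hr hβ
      exact ⟨le_iInf fun _ => le_iInf fun hest => le_iInf fun h =>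
        h.le_maxRisk hd hn hk hr hβ hsmall hest,
        (constrainedMinimaxRisk_le_maxRisk hm hs).trans hrisk, hrisk⟩
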